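/- Let $\mathbb{C}_+=\{w\in\mathbb{C}:\operatorname{Re} w>0\}$, and let $H^2(\mathbb{C}_+)$ be the Hardy space of analytic functions $f:\mathbb{C}_+\to\mathbb{C}$ with $\|f\|=\bigl(\sup_{x>0}\int_{-\infty}^{\infty}|f(x+iy)|^2\,dy\bigr)^{1/2}<\infty$. A bounded linear operator $U$ on a Banach space $\mathcal{B}$ is called universal for $\mathcal{B}$ if for every bounded linear operator $T$ on $\mathcal{B}$ there are a scalar $\alpha\neq 0$ and a closed subspace $\mathcal{M}$ with $U\mathcal{M}\subseteq\mathcal{M}$ such that $U|_{\mathcal{M}}$ is similar to $\alpha T$, that is, $X\,U|_{\mathcal{M}}=\alpha T X$ for some bounded invertible linear map $X:\mathcal{M}\to\mathcal{B}$. Let $\psi:\mathbb{C}_+\to\mathbb{C}_+$ be an affine self-map, i.e. $\psi(w)=aw+b$ for some $a,b\in\mathbb{C}$ with $a\neq 0$, and let $C_\psi f=f\circ\psi$ be the (bounded) composition operator on $H^2(\mathbb{C}_+)$ with symbol $\psi$. Then $C_\psi-\lambda I$ is universal for $H^2(\mathbb{C}_+)$ for some $\lambda\in\mathbb{C}$ if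 and only if $\psi$ is a hyperbolic non-automorphism of type II, i.e. $\psi(w)=aw+b$ with $a\in(1,\infty)$ and $\operatorname{Re} b>0$. -/

import Mathlib

open MeasureTheory
open scoped ENNReal

noncomputable section

/-- The open right half-plane `ℂ₊`. -/
abbrev RightHalfPlane : Type := {w : ℂ // 0 < w.re}

/-- The point `x + i y` of the right half-plane. -/
def RightHalfPlane.mk (x y : ℝ) (hx : 0 < x) : RightHalfPlane := ⟨⟨x, y⟩, hx⟩

/-- `f : ℂ₊ → ℂ` is analytic. -/
def IsHolomorphic (f : RightHalfPlane → ℂ) : Prop :=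
  ∃ g : ℂ → ℂ, DifferentiableOn ℂ g {w | 0 < w.re} ∧ ∀ w : RightHalfPlane, f w = g w

/-- `sup_{x > 0} (∫_ℝ |f (x + i y)|² dy)^{1/2}`, as an extended nonnegative number. -/
def hardyENorm (f : RightHalfPlane → ℂ) : ℝ≥0∞ :=
  ⨆ x : {x : ℝ // 0 < x},
    eLpNorm (fun y : ℝ => f (RightHalfPlane.mk x.1 y x.2)) 2 (volume : Measure ℝ)

theorem continuous_mk (x : ℝ) (hx : 0 < x) :
    Continuous fun y : ℝ => RightHalfPlane.mk x y hx := by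
  refine Continuous.subtype_mk ?_ _
  have : (fun y : ℝ => (⟨x, y⟩ : ℂ)) = fun y : ℝ => (x : ℂ) + y * Complex.I := by
    funext y
    exact Complex.mk_eq_add_mul_I x y
  change Continuous fun y : ℝ => (⟨x, y⟩ : ℂ)
  rw [this]
  fun_prop

theorem IsHolomorphic.continuous {f : RightHalfPlane → ℂ} (hf : IsHolomorphic f) :
    Continuous f := by
  obtain ⟨g, hg, hfg⟩ := hf
  have h := continuousOn_iff_continuous_domRestrict.mp hg.continuousOn
  have e : f = Set.domRestrict {w : ℂ | 0 < w.re} g := funext hfg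
  rw [e]
  exact h

theorem IsHolomorphic.continuous_line {f : RightHalfPlane → ℂ} (hf : IsHolomorphic f)
    (x : ℝ) (hx : 0 < x) : Continuous fun y : ℝ => f (RightHalfPlane.mk x y hx) :=
  hf.continuous.comp (continuous_mk x hx)

theorem hardyENorm_zero : hardyENorm 0 = 0 := by
  simp [hardyENorm]

theorem hardyENorm_add_le {f g : RightHalfPlane → ℂ} (hf : IsHolomorphic f)
    (hg : IsHolomorphic g) : hardyENorm (f + g) ≤ hardyENorm f + hardyENorm g := by
  refine iSup_le fun x => ?_
  refine (eLpNorm_add_le (hf.continuous_line x.1 x.2).aestronglyMeasurable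
    (hg.continuous_line x.1 x.2).aestronglyMeasurable (by norm_num)).trans ?_
  exact add_le_add
    (le_iSup (fun x : {x : ℝ // 0 < x} =>
      eLpNorm (fun y : ℝ => f (RightHalfPlane.mk x.1 y x.2)) 2 volume) x)
    (le_iSup (fun x : {x : ℝ // 0 < x} =>
      eLpNorm (fun y : ℝ => g (RightHalfPlane.mk x.1 y x.2)) 2 volume) x)

theorem hardyENorm_smul (c : ℂ) (f : RightHalfPlane → ℂ) :
    hardyENorm (c • f) = ‖c‖ₑ * hardyENorm f := by
  unfold hardyENorm
  rw [ENNReal.mul_iSup]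
  refine iSup_congr fun x => ?_
  exact eLpNorm_const_smul c (fun y : ℝ => f (RightHalfPlane.mk x.1 y x.2)) 2 volume

theorem eq_zero_of_hardyENorm_eq_zero {f : RightHalfPlane → ℂ} (hf : IsHolomorphic f)
    (h : hardyENorm f = 0) : f = 0 := by
  funext w
  have hx : 0 < w.1.re := w.2
  have h1 : eLpNorm (fun y : ℝ => f (RightHalfPlane.mk w.1.re y hx)) 2 volume = 0 :=
    (ENNReal.iSup_eq_zero.mp h) ⟨w.1.re, hx⟩
  have hc := hf.continuous_line w.1.re hx
  rw [eLpNorm_eq_zero_iff hc.aestronglyMeasurable (by norm_num)] at h1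
  have h2 := (hc.ae_eq_iff_eq volume continuous_zero).mp h1
  exact congrFun h2 w.1.im

/-- The linear space underlying `H²(ℂ₊)`: the analytic functions on `ℂ₊` with finite norm. -/
def hardySubmodule : Submodule ℂ (RightHalfPlane → ℂ) where
  carrier := {f | IsHolomorphic f ∧ hardyENorm f < ∞}
  zero_mem' := ⟨⟨0, differentiableOn_const 0, fun _ => rfl⟩, by simp [hardyENorm_zero]⟩
  add_mem' := by
    rintro f g ⟨hf, hf'⟩ ⟨hg, hg'⟩
    refine ⟨?_, (hardyENorm_add_le hf hg).trans_lt (ENNReal.add_lt_top.mpr ⟨hf', hg'⟩)⟩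
    obtain ⟨F, hF, hfF⟩ := hf
    obtain ⟨G, hG, hgG⟩ := hg
    exact ⟨F + G, hF.add hG, fun w => by simp [hfF, hgG]⟩
  smul_mem' := by
    rintro c f ⟨hf, hf'⟩
    refine ⟨?_, ?_⟩
    · obtain ⟨F, hF, hfF⟩ := hf
      exact ⟨c • F, hF.const_smul c, fun w => by simp [hfF]⟩
    · rw [hardyENorm_smul]
      exact ENNReal.mul_lt_top enorm_lt_top hf'

/-- The Hardy space `H²(ℂ₊)` of the right half-plane. It is a type of its own, so that its topology
is the one of the Hardy norm and not the one of pointwise convergence. -/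
def HardySpace : Type := hardySubmodule

namespace HardySpace

instance : AddCommGroup HardySpace := inferInstanceAs (AddCommGroup hardySubmodule)

instance : Module ℂ HardySpace := inferInstanceAs (Module ℂ hardySubmodule)

instance : CoeFun HardySpace fun _ => RightHalfPlane → ℂ := ⟨fun f => f.1⟩

theorem isHolomorphic (f : HardySpace) : IsHolomorphic (f : RightHalfPlane → ℂ) := f.2.1

theorem hardyENorm_lt_top (f : HardySpace) : hardyENorm f < ∞ := f.2.2

theorem coe_add (f g : HardySpace) : ((f + g : HardySpace) : RightHalfPlane → ℂ) = f + g := rfl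

theorem coe_smul (c : ℂ) (f : HardySpace) :
    ((c • f : HardySpace) : RightHalfPlane → ℂ) = c • (f : RightHalfPlane → ℂ) := rfl

theorem coe_neg (f : HardySpace) :
    ((-f : HardySpace) : RightHalfPlane → ℂ) = -(f : RightHalfPlane → ℂ) := rfl

/-- The norm `‖f‖ = (sup_{x > 0} ∫_ℝ |f (x + i y)|² dy)^{1/2}`. -/
def groupNorm : AddGroupNorm HardySpace where
  toFun f := (hardyENorm f).toReal
  map_zero' := by
    change (hardyENorm 0).toReal = 0
    rw [hardyENorm_zero, ENNReal.toReal_zero]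
  add_le' f g := by
    rw [coe_add, ← ENNReal.toReal_add f.hardyENorm_lt_top.ne g.hardyENorm_lt_top.ne]
    exact ENNReal.toReal_mono
      (ENNReal.add_lt_top.mpr ⟨f.hardyENorm_lt_top, g.hardyENorm_lt_top⟩).ne
      (hardyENorm_add_le f.isHolomorphic g.isHolomorphic)
  neg' f := by
    rw [coe_neg, ← neg_one_smul ℂ (f : RightHalfPlane → ℂ), hardyENorm_smul]
    simp
  eq_zero_of_map_eq_zero' f h := by
    rcases (ENNReal.toReal_eq_zero_iff _).mp h with h | h
    · exact Subtype.ext (eq_zero_of_hardyENorm_eq_zero f.isHolomorphic h)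
    · exact absurd h f.hardyENorm_lt_top.ne

instance : NormedAddCommGroup HardySpace := groupNorm.toNormedAddCommGroup

theorem norm_def (f : HardySpace) : ‖f‖ = (hardyENorm f).toReal := rfl

instance : NormedSpace ℂ HardySpace where
  norm_smul_le c f := by
    rw [norm_def, norm_def, coe_smul, hardyENorm_smul, ENNReal.toReal_mul, toReal_enorm]

end HardySpace

/-- `ψ : ℂ₊ → ℂ₊` is affine: `ψ w = a w + b` with complex `a ≠ 0` and `b`. -/
def IsAffineSelfMap (ψ : RightHalfPlane → RightHalfPlane) : Prop :=
  ∃ a b : ℂ, a ≠ 0 ∧ ∀ w : RightHalfPlane, (ψ w : ℂ) = a * w + b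

/-- `ψ` is a hyperbolic non-automorphism of type II: `ψ w = a w + b` with `a ∈ (1, ∞)` and
`Re b > 0`. -/
def IsHyperbolicNonAutTypeII (ψ : RightHalfPlane → RightHalfPlane) : Prop :=
  ∃ (a : ℝ) (b : ℂ), 1 < a ∧ 0 < b.re ∧ ∀ w : RightHalfPlane, (ψ w : ℂ) = a * w + b

theorem IsAffineSelfMap.exists_real {ψ : RightHalfPlane → RightHalfPlane}
    (hψ : IsAffineSelfMap ψ) :
    ∃ (a : ℝ) (b : ℂ), 0 < a ∧ 0 ≤ b.re ∧ ∀ w : RightHalfPlane, (ψ w : ℂ) = a * w + b := by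
  obtain ⟨a, b, ha, h⟩ := hψ
  have key : ∀ x y : ℝ, 0 < x → 0 < a.re * x - a.im * y + b.re := by
    intro x y hx
    have h1 := (ψ (RightHalfPlane.mk x y hx)).2
    rw [h] at h1
    simpa [RightHalfPlane.mk] using h1
  have him : a.im = 0 := by
    by_contra hne
    have h1 := key 1 ((a.re + b.re) / a.im) one_pos
    have h2 : a.im * ((a.re + b.re) / a.im) = a.re + b.re := by field_simp
    rw [h2] at h1
    linarith
  have hre : 0 < a.re := by
    have hne : a.re ≠ 0 := fun h0 => ha (Complex.ext h0 him)
    by_contra hle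
    have hlt : a.re < 0 := lt_of_le_of_ne (not_lt.mp hle) hne
    have hpos : 0 < (|b.re| + 1) / (-a.re) := by
      have := abs_nonneg b.re
      have : 0 < -a.re := by linarith
      positivity
    have h1 := key _ 0 hpos
    have h2 : a.re * ((|b.re| + 1) / (-a.re)) = -(|b.re| + 1) := by
      field_simp
    rw [h2] at h1
    have := le_abs_self b.re
    linarith
  have hb : 0 ≤ b.re := by
    by_contra hlt
    have hlt : b.re < 0 := not_le.mp hlt
    have hpos : 0 < -b.re / a.re := div_pos (by linarith) hre
    have h1 := key _ 0 hpos
    have h2 : a.re * (-b.re / a.re) = -b.re := by field_simp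
    rw [h2] at h1
    linarith
  refine ⟨a.re, b, hre, hb, fun w => ?_⟩
  rw [h w]
  congr 2
  exact Complex.ext (by simp) (by simp [him])

theorem IsHolomorphic.comp_affine {f : RightHalfPlane → ℂ} (hf : IsHolomorphic f)
    {ψ : RightHalfPlane → RightHalfPlane} (hψ : IsAffineSelfMap ψ) :
    IsHolomorphic (f ∘ ψ) := by
  obtain ⟨a, b, -, h⟩ := hψ
  obtain ⟨g, hg, hfg⟩ := hf
  refine ⟨fun w => g (a * w + b), ?_, fun w => ?_⟩
  · refine hg.comp (by fun_prop) ?_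
    intro w hw
    have h1 := (ψ ⟨w, hw⟩).2
    rw [h] at h1
    exact h1
  · simp [hfg, h]

theorem hardyENorm_comp_affine {ψ : RightHalfPlane → RightHalfPlane}
    (hψ : IsAffineSelfMap ψ) : ∃ C : ℝ≥0∞, C ≠ ∞ ∧
      ∀ f : RightHalfPlane → ℂ, IsHolomorphic f → hardyENorm (f ∘ ψ) ≤ C * hardyENorm f := by
  obtain ⟨a, b, ha, hb, h⟩ := hψ.exists_real
  refine ⟨ENNReal.ofReal |a⁻¹| ^ (1 / (2 : ℝ≥0∞)).toReal,
    ENNReal.rpow_ne_top_of_nonneg ENNReal.toReal_nonneg ENNReal.ofReal_ne_top, fun f hf => ?_⟩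
  refine iSup_le fun x => ?_
  have hx' : 0 < a * x.1 + b.re := by
    have := mul_pos ha x.2
    linarith
  set F : ℝ → ℂ := fun y => f (RightHalfPlane.mk (a * x.1 + b.re) y hx') with hF
  have hFc : Continuous F := hf.continuous_line _ hx'
  have e : (fun y : ℝ => (f ∘ ψ) (RightHalfPlane.mk x.1 y x.2))
      = (fun y => F (y + b.im)) ∘ fun y => a * y := by
    funext y
    simp only [Function.comp, hF]
    congr 1
    refine Subtype.ext ?_
    rw [h]
    refine Complex.ext ?_ ?_ <;> simp [RightHalfPlane.mk]
  have hm : Measurable fun y : ℝ => a * y := by fun_prop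
  have hFc' : Continuous fun y => F (y + b.im) := by fun_prop
  have e2 : eLpNorm (fun y => F (y + b.im)) 2 (volume : Measure ℝ) = eLpNorm F 2 volume :=
    eLpNorm_comp_measurePreserving hFc.aestronglyMeasurable
      (measurePreserving_add_right (volume : Measure ℝ) b.im)
  rw [e, ← eLpNorm_map_measure hFc'.aestronglyMeasurable hm.aemeasurable,
    Real.map_volume_mul_left ha.ne', eLpNorm_smul_measure_of_ne_top (by norm_num), e2, smul_eq_mul]
  gcongr
  exact le_iSup (fun x : {x : ℝ // 0 < x} =>
    eLpNorm (fun y : ℝ => f (RightHalfPlane.mk x.1 y x.2)) 2 volume) ⟨_, hx'⟩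

/-- The composition operator `C_ψ f = f ∘ ψ`, a bounded linear operator on `H²(ℂ₊)`, for an affine
self-map `ψ` of `ℂ₊`. -/
def compositionOperator (ψ : RightHalfPlane → RightHalfPlane) (hψ : IsAffineSelfMap ψ) :
    HardySpace →L[ℂ] HardySpace :=
  LinearMap.mkContinuousOfExistsBound
    { toFun := fun f => ⟨f ∘ ψ, f.isHolomorphic.comp_affine hψ, by
        obtain ⟨C, hC, h⟩ := hardyENorm_comp_affine hψ
        exact (h f f.isHolomorphic).trans_lt
          (ENNReal.mul_lt_top hC.lt_top f.hardyENorm_lt_top)⟩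
      map_add' := fun _ _ => rfl
      map_smul' := fun _ _ => rfl }
    (by
      obtain ⟨C, hC, h⟩ := hardyENorm_comp_affine hψ
      refine ⟨C.toReal, fun f => ?_⟩
      rw [HardySpace.norm_def, HardySpace.norm_def, ← ENNReal.toReal_mul]
      exact ENNReal.toReal_mono (ENNReal.mul_lt_top hC.lt_top f.hardyENorm_lt_top).ne
        (h f f.isHolomorphic))

theorem compositionOperator_apply (ψ : RightHalfPlane → RightHalfPlane)
    (hψ : IsAffineSelfMap ψ) (f : HardySpace) (w : RightHalfPlane) :
    compositionOperator ψ hψ f w = f (ψ w) := rfl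

/-- A bounded operator `U` on `B` is universal for `B` if for every bounded operator `T` on `B` there
are a scalar `α ≠ 0` and a closed invariant subspace `M` of `U` such that `U|_M` is similar to
`α T`, through a bounded invertible `X : M → B`. -/
def IsUniversal {B : Type*} [NormedAddCommGroup B] [NormedSpace ℂ B] (U : B →L[ℂ] B) : Prop :=
  ∀ T : B →L[ℂ] B, ∃ α : ℂ, α ≠ 0 ∧
    ∃ M : Submodule ℂ B, IsClosed (M : Set B) ∧
      ∃ (hM : ∀ x ∈ M, U x ∈ M) (X : M ≃L[ℂ] B),
        ∀ x : M, X ⟨U x, hM x x.2⟩ = (α • T) (X x)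

end

/-!
`C_ψ - μ` fails to be universal for soft reasons unless `ψ w = a w + b` with `a > 1` and `Re b > 0`,
and in that case `μ = 1 / a` works.

The analytic tool is to pair `f` with a test function `k` on vertical lines: the function
`w ↦ ∫ f (w + i t) k t dt` (`linePairing`) is holomorphic on the half-plane and bounded by
`‖f‖ ‖k‖`, and by duality (`eLpNorm_two_le_of_forall_pairing`) scalar theorems about such functions
give estimates for the mean-square norm of `f` on vertical lines. The Phragmén–Lindelöf principle
shows that this norm decreases to the right, the three lines theorem that it is log-convex, and
Cauchy's estimate that `f - f (· + c)` has size `O(1 / x)` on `Re w = x` and that point evaluations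
are bounded. Hence `H²` is complete, its norm satisfies the parallelogram law, and it is a separable
Hilbert space; neither boundary values nor the Paley–Wiener theorem are needed.

*Universality.* By `isUniversal_of_rightInverse_of_isometry` it is enough that `U = C_ψ - 1 / a` has
a right inverse and that its kernel contains an isometric copy of `H²`, that is, that the kernel is
infinite-dimensional. Let `-q` be the fixed point of `ψ`, so that `Re q > 0`, and let `u = w + q`. The
functions `ζᵏ / u` with `ζ = exp (2 π i log u / log a)` are linearly independent elements of the
kernel. To solve `U f = g`, let `D` be the translation by `q` and write `g = D g + (1 - D) g`. The
operators `C_ψ⁻ⁿ D`, which are compositions with `a⁻ⁿ (w + q)`, have norm at most `a ^ (n / 2)`, while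
`C_ψⁿ (1 - D)` has norm `O(a ^ (-3 n / 2))`. Since `1 / a` lies strictly between `a ^ (-3 / 2)` and
`a ^ (-1 / 2)`, one Neumann series converges on each summand.

*Non-universality.* If `a = 1` or `Re b = 0`, log-convexity makes `C_ψ` paranormal, so that
`(C_ψ - μ)²` and `C_ψ - μ` have the same kernel, and no nonzero operator of square zero can be
modelled. If `a < 1` and `Re b > 0`, then `C_ψ - μ` is injective, and zero cannot be modelled.
-/

/-! ### Universal operators -/

section Universal

variable {B : Type*} [NormedAddCommGroup B] [NormedSpace ℂ B]

/-- A criterion of Caradus type: an operator with a right inverse `S` whose kernel contains an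
isometric copy of the whole space is universal. For small `α` the equation `V = J + α S V T` has a
solution `V` close to `J`, hence bounded below, and applying `U` to it gives `U V = α V T`. -/
theorem isUniversal_of_rightInverse_of_isometry [CompleteSpace B] (U S : B →L[ℂ] B)
    (J : B →ₗᵢ[ℂ] B) (hS : ∀ x, U (S x) = x) (hJ : ∀ x, U (J x) = 0) : IsUniversal U := by
  intro T
  -- With `α = 1 / c` the map `V ↦ α S V T` has norm at most `1 / 4`, so that `‖V - J‖ ≤ 1 / 3`.
  set c : ℝ := 4 * (‖S‖ * ‖T‖ + 1) with hc
  have hc0 : 0 < c := by positivity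
  have hcn : ‖((c⁻¹ : ℝ) : ℂ)‖ = c⁻¹ := by
    rw [Complex.norm_real, Real.norm_of_nonneg (inv_nonneg.mpr hc0.le)]
  set α : ℂ := ((c⁻¹ : ℝ) : ℂ) with hα
  have hα0 : α ≠ 0 := by
    rw [hα]; exact_mod_cast (inv_pos.mpr hc0).ne'
  have hbound : ∀ V : B →L[ℂ] B, ‖α • (S ∘L V ∘L T)‖ ≤ 1 / 4 * ‖V‖ := by
    intro V
    have h1 : ‖S ∘L V ∘L T‖ ≤ ‖S‖ * (‖V‖ * ‖T‖) :=
      (S.opNorm_comp_le _).trans (by gcongr; exact V.opNorm_comp_le T)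
    rw [norm_smul, hcn]
    have h2 : c⁻¹ * (‖S‖ * ‖T‖) ≤ 1 / 4 := by
      rw [inv_mul_le_iff₀ hc0, hc]; linarith
    calc c⁻¹ * ‖S ∘L V ∘L T‖ ≤ c⁻¹ * (‖S‖ * (‖V‖ * ‖T‖)) := by gcongr
      _ = c⁻¹ * (‖S‖ * ‖T‖) * ‖V‖ := by ring
      _ ≤ 1 / 4 * ‖V‖ := by gcongr
  let Φ : (B →L[ℂ] B) → (B →L[ℂ] B) := fun V => J.toContinuousLinearMap + α • (S ∘L V ∘L T)
  have hΦ : ContractingWith (1 / 4 : NNReal) Φ := by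
    refine ⟨by rw [← NNReal.coe_lt_coe]; norm_num, LipschitzWith.of_dist_le_mul fun V W => ?_⟩
    have e : Φ V - Φ W = α • (S ∘L (V - W) ∘L T) := by
      ext x; simp [Φ, smul_sub]
    rw [dist_eq_norm, dist_eq_norm, e]
    simpa using hbound (V - W)
  obtain ⟨V, hV⟩ : ∃ V, Φ V = V := ⟨_, hΦ.fixedPoint_isFixedPt⟩
  have hVx : ∀ x, V x = J x + α • S (V (T x)) := fun x => by
    conv_lhs => rw [← hV]
    simp [Φ]
  have hVn : ‖V‖ ≤ 4 / 3 := by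
    have h1 : ‖V‖ ≤ ‖J.toContinuousLinearMap‖ + 1 / 4 * ‖V‖ := by
      conv_lhs => rw [← hV]
      exact (norm_add_le _ _).trans (by gcongr; exact hbound V)
    have := J.norm_toContinuousLinearMap_le
    linarith
  have hlow : ∀ x, ‖x‖ ≤ (3 / 2 : NNReal) * ‖V x‖ := by
    intro x
    have h1 : ‖α • S (V (T x))‖ ≤ 1 / 3 * ‖x‖ := by
      have := (α • (S ∘L V ∘L T)).le_opNorm x
      have h2 := hbound V
      refine this.trans ?_
      gcongr
      linarith
    have h2 : ‖J x‖ ≤ ‖V x‖ + ‖α • S (V (T x))‖ := by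
      have : J x = V x - α • S (V (T x)) := by rw [hVx x]; abel
      rw [this]; exact norm_sub_le _ _
    rw [J.norm_map] at h2
    push_cast
    linarith
  have hanti := ContinuousLinearMap.antilipschitz_of_bound V hlow
  have hcl : IsClosed (Set.range V) := hanti.isClosed_range V.uniformContinuous
  have hUV : ∀ x, U (V x) = V (α • T x) := fun x => by
    rw [hVx x, map_add, hJ, map_smul, hS, zero_add, map_smul]
  have hmem : ∀ y ∈ V.range, U y ∈ V.range := by
    rintro _ ⟨x, rfl⟩
    exact ⟨α • T x, (hUV x).symm⟩
  refine ⟨α, hα0, V.range, hcl, hmem, (V.equivRange hanti.injective hcl).symm, ?_⟩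
  rintro ⟨_, x, rfl⟩
  have h1 : (V.equivRange hanti.injective hcl).symm ⟨V x, ⟨x, rfl⟩⟩ = x := by
    rw [ContinuousLinearEquiv.symm_apply_eq]; rfl
  rw [ContinuousLinearEquiv.symm_apply_eq]
  refine Subtype.ext ?_
  change U (V x) = V ((α • T) ((V.equivRange hanti.injective hcl).symm ⟨V x, ⟨x, rfl⟩⟩))
  rw [h1, hUV]
  rfl

/-- An injective operator has no nonzero subspace on which it vanishes, so it cannot model the zero
operator. -/
theorem not_isUniversal_of_injective [Nontrivial B] {U : B →L[ℂ] B}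
    (hU : ∀ x, U x = 0 → x = 0) : ¬ IsUniversal U := by
  intro h
  obtain ⟨α, -, M, -, hM, X, hX⟩ := h 0
  obtain ⟨y, hy⟩ := exists_ne (0 : B)
  have h1 := hX (X.symm y)
  have h2 : (⟨U (X.symm y), hM _ (X.symm y).2⟩ : M) = 0 := by
    rw [← X.map_eq_zero_iff, h1]; simp
  have h3 := hU _ (congrArg Subtype.val h2)
  apply hy
  rw [← X.apply_symm_apply y, Submodule.coe_eq_zero.mp h3, map_zero]

/-- If `ker U² = ker U`, then `U` cannot model a nonzero operator with square zero. -/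
theorem not_isUniversal_of_ker_sq {U : B →L[ℂ] B} (hU : ∀ x, U (U x) = 0 → U x = 0)
    {T : B →L[ℂ] B} (hT : T ≠ 0) (hT2 : ∀ x, T (T x) = 0) : ¬ IsUniversal U := by
  intro h
  obtain ⟨α, hα, M, -, hM, X, hX⟩ := h T
  apply hT
  ext y
  have h1 := hX (X.symm y)
  have h2 := hX ⟨U (X.symm y), hM _ (X.symm y).2⟩
  rw [h1] at h2
  have h3 : X ⟨U (U (X.symm y)), hM _ (hM _ (X.symm y).2)⟩ = 0 := by
    rw [h2]; simp [hT2]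
  have h4 := hU _ (congrArg Subtype.val (X.map_eq_zero_iff.mp h3))
  have h5 : (⟨U (X.symm y), hM _ (X.symm y).2⟩ : M) = 0 := Subtype.ext h4
  rw [h5, map_zero] at h1
  simpa [hα] using h1.symm

/-- For a paranormal operator `C`, every `C - μ` has the same kernel as its square: otherwise `C / μ`
acts on some `f`, `v ≠ 0` by `f ↦ f + v`, `v ↦ v`, and `‖f + n v‖` would be log-convex in `n`
although it grows linearly. -/
theorem ker_sq_sub_smul_of_paranormal {C : B →L[ℂ] B}
    (hC : ∀ x, ‖C x‖ ^ 2 ≤ ‖C (C x)‖ * ‖x‖) (μ : ℂ) (x : B)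
    (h : (C - μ • ContinuousLinearMap.id ℂ B) ((C - μ • ContinuousLinearMap.id ℂ B) x) = 0) :
    (C - μ • ContinuousLinearMap.id ℂ B) x = 0 := by
  set g := (C - μ • ContinuousLinearMap.id ℂ B) x with hg
  have hCx : C x = μ • x + g := by rw [hg]; simp
  have hCg : C g = μ • g := by
    have : C g - μ • g = 0 := by simpa using h
    exact sub_eq_zero.mp this
  rcases eq_or_ne μ 0 with rfl | hμ
  · have h1 : C x = g := by simpa using hCx
    have h2 := hC x
    rw [h1, hCg] at h2
    simp only [zero_smul, norm_zero, zero_mul] at h2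
    exact norm_eq_zero.mp (pow_eq_zero_iff two_ne_zero |>.mp (le_antisymm h2 (sq_nonneg _)))
  set v := μ⁻¹ • g with hv
  have hgv : g = μ • v := by rw [hv, smul_inv_smul₀ hμ]
  have hCv : C v = μ • v := by rw [hv, map_smul, hCg, smul_comm]
  set y : ℕ → B := fun n => x + n • v with hy
  have hCy : ∀ n, C (y n) = μ • y (n + 1) := fun n => by
    simp only [hy, map_add, map_nsmul, hCx, hCv, hgv, smul_add, add_smul, one_smul]
    rw [smul_comm n μ v]; abel
  set s : ℕ → ℝ := fun n => ‖y n‖ with hs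
  have hs0 : ∀ n, 0 ≤ s n := fun n => norm_nonneg _
  have hconv : ∀ n, s (n + 1) ^ 2 ≤ s (n + 2) * s n := fun n => by
    have h1 := hC (y n)
    rw [hCy, map_smul, hCy, norm_smul, norm_smul, norm_smul] at h1
    have h2 : 0 < ‖μ‖ ^ 2 := by positivity
    have h3 : ‖μ‖ ^ 2 * s (n + 1) ^ 2 ≤ ‖μ‖ ^ 2 * (s (n + 2) * s n) := by
      calc _ = (‖μ‖ * ‖y (n + 1)‖) ^ 2 := by simp only [hs]; ring
        _ ≤ _ := h1
        _ = _ := by simp only [hs]; ring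
    exact le_of_mul_le_mul_left h3 h2
  have hup : ∀ n : ℕ, s n ≤ ‖x‖ + n * ‖v‖ := fun n =>
    (norm_add_le _ _).trans (by gcongr; exact norm_nsmul_le)
  have hlow : ∀ n : ℕ, n * ‖v‖ ≤ s n + ‖x‖ := fun n => by
    have : n • v = y n - x := by simp [hy]
    calc (n : ℝ) * ‖v‖ = ‖n • v‖ := by
          rw [← Nat.cast_smul_eq_nsmul ℂ, norm_smul (n : ℂ) v, Complex.norm_natCast]
      _ ≤ s n + ‖x‖ := by rw [this]; exact norm_sub_le _ _
  -- If `s` increased once, log-convexity would make it grow geometrically from there on.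
  have hanti : ∀ n, s (n + 1) ≤ s n := by
    intro N
    by_contra! hlt
    have hpos : 0 < s N := by
      refine lt_of_le_of_ne (hs0 N) fun h0 => ?_
      have h1 := hconv N
      rw [← h0, mul_zero] at h1
      have : 0 < s (N + 1) := (hs0 N).trans_lt hlt
      nlinarith
    set r := s (N + 1) / s N with hr
    have hr1 : 1 < r := (one_lt_div hpos).mpr hlt
    have hind : ∀ k, 0 < s (N + k) ∧ r * s (N + k) ≤ s (N + (k + 1)) := by
      intro k
      induction k with
      | zero => exact ⟨hpos, by rw [hr]; field_simp; simp⟩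
      | succ k ih =>
        obtain ⟨h1, h2⟩ := ih
        have h3 : 0 < s (N + (k + 1)) := by nlinarith
        refine ⟨h3, ?_⟩
        have h4 : s (N + (k + 1)) ^ 2 ≤ s (N + (k + 1 + 1)) * s (N + k) := hconv (N + k)
        have h5 : 0 < s (N + (k + 1 + 1)) := by
          by_contra! hle
          nlinarith
        have h6 : s (N + k) * (r * s (N + (k + 1))) ≤ s (N + k) * s (N + (k + 1 + 1)) := by
          nlinarith
        exact le_of_mul_le_mul_left h6 h1
    have hgeo : ∀ k, s N * r ^ k ≤ s (N + k) := by
      intro k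
      induction k with
      | zero => simp
      | succ k ih =>
        calc s N * r ^ (k + 1) = r * (s N * r ^ k) := by ring
          _ ≤ r * s (N + k) := by gcongr
          _ ≤ _ := (hind k).2
    have hlim : Filter.Tendsto (fun k : ℕ => ((k : ℝ) ^ 1 + 1) / r ^ k) Filter.atTop (nhds 0) := by
      simp_rw [add_div]
      have h1 := tendsto_pow_const_div_const_pow_of_one_lt 1 hr1
      have h2 := tendsto_pow_const_div_const_pow_of_one_lt 0 hr1
      simp only [pow_zero] at h2
      simpa using h1.add h2
    set K : ℝ := ‖x‖ + N * ‖v‖ + ‖v‖ with hK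
    have hK0 : 0 ≤ K := by positivity
    have hlim' := hlim.const_mul K
    rw [mul_zero] at hlim'
    obtain ⟨k, hk⟩ := (hlim'.eventually (gt_mem_nhds hpos)).exists
    have h1 := (hgeo k).trans (hup (N + k))
    have hrk : 0 < r ^ k := by positivity
    have h2 : K * ((k : ℝ) ^ 1 + 1) < s N * r ^ k := by
      rw [← mul_div_assoc, div_lt_iff₀ hrk] at hk; exact hk
    push_cast at h1
    have : (0 : ℝ) ≤ k := Nat.cast_nonneg k
    have h3 : 0 ≤ ‖v‖ := norm_nonneg v
    have h4 : 0 ≤ ‖x‖ := norm_nonneg x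
    have h5 : 0 ≤ (N : ℝ) := Nat.cast_nonneg N
    have h6 : ‖x‖ + (N + k) * ‖v‖ ≤ K * ((k : ℝ) ^ 1 + 1) := by
      rw [hK]
      have : 0 ≤ (k : ℝ) * ‖x‖ := by positivity
      have : 0 ≤ (k : ℝ) * (N * ‖v‖) := by positivity
      nlinarith
    linarith
  have hbd : ∀ n, s n ≤ ‖x‖ := fun n => by
    induction n with
    | zero => simp [hs, hy]
    | succ n ih => exact (hanti n).trans ih
  have hv0 : ‖v‖ = 0 := by
    by_contra hne
    have hvp : 0 < ‖v‖ := lt_of_le_of_ne (norm_nonneg _) (Ne.symm hne)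
    obtain ⟨n, hn⟩ := exists_nat_gt (2 * ‖x‖ / ‖v‖)
    rw [div_lt_iff₀ hvp] at hn
    linarith [hlow n, hbd n]
  rw [hgv, norm_eq_zero.mp hv0, smul_zero]

end Universal

/-- If the forward Neumann series converges on the range of `1 - D` and the backward one on the range
of `D`, the two add up to a right inverse of `C - μ`. Here `E n` stands for `C⁻⁽ⁿ⁺¹⁾ D`, which makes
sense even if `C` is not invertible. -/
theorem exists_rightInverse_sub_smul {B : Type*} [NormedAddCommGroup B] [NormedSpace ℂ B]
    [CompleteSpace B] (C D : B →L[ℂ] B) (E : ℕ → B →L[ℂ] B) {μ : ℂ} (hμ : μ ≠ 0)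
    (hE0 : C * E 0 = D) (hE : ∀ n, C * E (n + 1) = E n)
    (hsE : Summable fun n => μ ^ n • E n)
    (hsC : Summable fun n : ℕ => (μ⁻¹) ^ (n + 1) • (C ^ n * (1 - D))) :
    ∃ S : B →L[ℂ] B, ∀ x, (C - μ • ContinuousLinearMap.id ℂ B) (S x) = x := by
  set S₁ := ∑' n, μ ^ n • E n with hS₁
  set S₂ := ∑' n : ℕ, (μ⁻¹) ^ (n + 1) • (C ^ n * (1 - D)) with hS₂
  have h1 : C * S₁ = D + μ • S₁ := by
    rw [hS₁, ← hsE.tsum_mul_left, (hsE.mul_left C).tsum_eq_zero_add, ← tsum_const_smul'' μ]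
    congr 1
    · simp [hE0]
    · refine tsum_congr fun n => ?_
      rw [mul_smul_comm, hE, smul_smul, pow_succ']
  have h2 : μ • S₂ = (1 - D) + C * S₂ := by
    have e : S₂ = μ⁻¹ • (1 - D) + μ⁻¹ • (C * S₂) := by
      conv_lhs => rw [hS₂, hsC.tsum_eq_zero_add]
      rw [hS₂, ← hsC.tsum_mul_left, ← tsum_const_smul'' μ⁻¹]
      congr 1
      · simp
      · refine tsum_congr fun n => ?_
        rw [mul_smul_comm, smul_smul, ← mul_assoc, ← pow_succ', ← pow_succ']
    conv_lhs => rw [e]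
    rw [smul_add, smul_inv_smul₀ hμ, smul_inv_smul₀ hμ]
  refine ⟨S₁ - S₂, fun x => ?_⟩
  have h3 : (C - μ • (1 : B →L[ℂ] B)) * (S₁ - S₂) = 1 := by
    rw [sub_mul, mul_sub, smul_mul_assoc, one_mul, smul_sub, h1, h2]
    abel
  exact congrArg (fun A : B →L[ℂ] B => A x) h3

/-! ### Isometric embeddings of separable Hilbert spaces -/

/-- A separable Hilbert space embeds isometrically into every infinite-dimensional one. -/
theorem exists_linearIsometry_of_linearIndependent {E F : Type*} [NormedAddCommGroup E]
    [InnerProductSpace ℂ E] [CompleteSpace E] [TopologicalSpace.SeparableSpace E]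
    [NormedAddCommGroup F] [InnerProductSpace ℂ F] [CompleteSpace F] (e : ℕ → F)
    (he : LinearIndependent ℂ e) : Nonempty (E →ₗᵢ[ℂ] F) := by
  obtain ⟨w, b, hb⟩ := exists_hilbertBasis ℂ E
  have hcount : Countable w := by
    have hd : Pairwise (Function.onFun Disjoint fun i : w => Metric.ball (b i) (1 / 2)) := by
      intro i j hij
      refine Metric.ball_disjoint_ball ?_
      have h1 : ‖b i - b j‖ ^ 2 = 2 := by
        rw [@norm_sub_sq ℂ, b.orthonormal.norm_eq_one, b.orthonormal.norm_eq_one,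
          b.orthonormal.inner_eq_zero hij]
        norm_num
      rw [dist_eq_norm]
      nlinarith [norm_nonneg (b i - b j)]
    exact hd.countable_of_isOpen_disjoint (fun _ => Metric.isOpen_ball)
      fun i => ⟨b i, Metric.mem_ball_self (by norm_num)⟩
  obtain ⟨φ, hφ⟩ := exists_injective_nat w
  have ho : Orthonormal ℂ (InnerProductSpace.gramSchmidtNormed ℂ e ∘ φ) :=
    (InnerProductSpace.gramSchmidtNormed_orthonormal he).comp φ hφ
  exact ⟨ho.orthogonalFamily.linearIsometry.comp b.repr.toLinearIsometry⟩

/-! ### Pairing a holomorphic function with a test function on vertical lines -/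

/-- The `L²` norm of `k` on the interval between `α` and `β`. -/
noncomputable def l2NormOn (k : ℝ → ℂ) (α β : ℝ) : ℝ :=
  (eLpNorm k 2 (volume.restrict (Set.uIoc α β))).toReal

theorem l2NormOn_nonneg (k : ℝ → ℂ) (α β : ℝ) : 0 ≤ l2NormOn k α β := ENNReal.toReal_nonneg

theorem memLp_uIoc_of_continuous {k : ℝ → ℂ} (hk : Continuous k) (α β : ℝ) :
    MemLp k 2 (volume.restrict (Set.uIoc α β)) := by
  obtain ⟨C, hC⟩ := (isCompact_uIcc (a := α) (b := β)).exists_bound_of_continuousOn hk.continuousOn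
  have : IsFiniteMeasure (volume.restrict (Set.uIoc α β)) :=
    ⟨by rw [Measure.restrict_apply_univ, Set.uIoc]; exact measure_Ioc_lt_top⟩
  refine MemLp.of_bound hk.aestronglyMeasurable C ?_
  filter_upwards [ae_restrict_mem measurableSet_uIoc] with t ht
  exact hC t (Set.uIoc_subset_uIcc ht)

/-- Pairing with conjugates of the function itself recovers its `L²` norm on the line. -/
theorem eLpNorm_two_le_of_forall_pairing {u : ℝ → ℂ} (hu : Continuous u) {M : ℝ} (hM : 0 ≤ M)
    (h : ∀ (R : ℝ) (k : ℝ → ℂ), 0 < R → Continuous k →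
      ‖∫ t in (-R)..R, u t * k t‖ ≤ M * l2NormOn k (-R) R) :
    eLpNorm u 2 volume ≤ ENNReal.ofReal M := by
  have key : ∀ R : ℝ, 0 < R →
      eLpNorm u 2 (volume.restrict (Set.Ioc (-R) R)) ≤ ENNReal.ofReal M := by
    intro R hR
    have hle : -R ≤ R := by linarith
    set k : ℝ → ℂ := fun t => starRingEnd ℂ (u t) with hk
    have hkc : Continuous k := Complex.continuous_conj.comp hu
    have hmem := memLp_uIoc_of_continuous hu (-R) R
    have hK : l2NormOn k (-R) R = l2NormOn u (-R) R := by
      unfold l2NormOn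
      congr 1
      exact eLpNorm_congr_norm_ae (Filter.Eventually.of_forall fun t => by simp [hk])
    have hsq : ‖∫ t in (-R)..R, u t * k t‖ = l2NormOn u (-R) R ^ 2 := by
      have e1 : ∀ t, u t * k t = ((‖u t‖ ^ 2 : ℝ) : ℂ) := fun t => by
        rw [hk, Complex.mul_conj, Complex.normSq_eq_norm_sq]
      simp_rw [e1]
      rw [intervalIntegral.integral_ofReal, Complex.norm_real, Real.norm_eq_abs, abs_of_nonneg
        (intervalIntegral.integral_nonneg hle fun _ _ => by positivity), l2NormOn,
        hmem.eLpNorm_eq_integral_rpow_norm (by norm_num) (by norm_num),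
        ENNReal.toReal_ofReal (by positivity), intervalIntegral.integral_of_le hle,
        Set.uIoc_of_le hle]
      have h0 : 0 ≤ ∫ t in Set.Ioc (-R) R, ‖u t‖ ^ 2 := integral_nonneg fun _ => by positivity
      simp only [ENNReal.toReal_ofNat, Real.rpow_ofNat]
      rw [← Real.rpow_natCast, ← Real.rpow_mul h0]
      norm_num
    have h1 := h R k hR hkc
    rw [hsq, hK] at h1
    have h2 : l2NormOn u (-R) R ≤ M := by
      by_contra! hlt
      nlinarith [l2NormOn_nonneg u (-R) R]
    rw [← Set.uIoc_of_le hle]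
    exact ENNReal.le_ofReal_iff_toReal_le hmem.eLpNorm_ne_top hM |>.mpr h2
  have hlim : ∀ᵐ t ∂(volume : Measure ℝ), Filter.Tendsto
      (fun n : ℕ => (Set.Ioc (-((n : ℝ) + 1)) ((n : ℝ) + 1)).indicator u t)
      Filter.atTop (nhds (u t)) := by
    refine Filter.Eventually.of_forall fun t => tendsto_const_nhds.congr' ?_
    obtain ⟨N, hN⟩ := exists_nat_gt |t|
    filter_upwards [Filter.eventually_ge_atTop N] with n hn
    have h1 : (N : ℝ) ≤ n := by exact_mod_cast hn
    have h2 := abs_lt.mp hN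
    rw [Set.indicator_of_mem]
    constructor <;> linarith [h2.1, h2.2]
  refine (Lp.eLpNorm_lim_le_liminf_eLpNorm (fun n => ?_) u hlim).trans ?_
  · exact hu.aestronglyMeasurable.indicator measurableSet_Ioc
  · refine Filter.liminf_le_of_frequently_le' (Filter.Frequently.of_forall fun n => ?_)
    rw [eLpNorm_indicator_eq_eLpNorm_restrict measurableSet_Ioc]
    exact key _ (by positivity)

/-- The function `w ↦ ∫ F (w + i t) k(t) dt`, the integral being over the interval from `α` to
`β`. -/
noncomputable def linePairing (F : ℂ → ℂ) (k : ℝ → ℂ) (α β : ℝ) (w : ℂ) : ℂ :=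
  ∫ t in α..β, F (w + t * Complex.I) * k t

theorem isOpen_rightHalfPlane : IsOpen {w : ℂ | 0 < w.re} :=
  isOpen_lt continuous_const Complex.continuous_re

theorem continuous_line_of_continuousOn {F : ℂ → ℂ} (hF : ContinuousOn F {w | 0 < w.re})
    {w : ℂ} (hw : 0 < w.re) : Continuous fun t : ℝ => F (w + t * Complex.I) :=
  hF.comp_continuous (by fun_prop) fun t => by simpa using hw

theorem hasDerivAt_linePairing {F : ℂ → ℂ} (hF : DifferentiableOn ℂ F {w | 0 < w.re})
    {k : ℝ → ℂ} (hk : Continuous k) (α β : ℝ) {w : ℂ} (hw : 0 < w.re) :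
    HasDerivAt (linePairing F k α β) (linePairing (deriv F) k α β w) w := by
  have hF' : ContinuousOn (deriv F) {w | 0 < w.re} :=
    (hF.deriv isOpen_rightHalfPlane).continuousOn
  have hr : 0 < w.re / 2 := by linarith
  have hball : ∀ z ∈ Metric.closedBall w (w.re / 2), 0 < z.re := fun z hz => by
    have h1 := Complex.abs_re_le_norm (z - w)
    rw [mem_closedBall_iff_norm] at hz
    have h2 := abs_le.mp (h1.trans hz)
    rw [Complex.sub_re] at h2
    linarith [h2.1]
  obtain ⟨C, hC⟩ : ∃ C, ∀ p ∈ Metric.closedBall w (w.re / 2) ×ˢ Set.uIcc α β,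
      ‖deriv F (p.1 + (p.2 : ℝ) * Complex.I) * k p.2‖ ≤ C := by
    refine ((isCompact_closedBall w _).prod isCompact_uIcc).exists_bound_of_continuousOn ?_
    refine ContinuousOn.mul (hF'.comp (by fun_prop) ?_) (by fun_prop)
    rintro ⟨z, t⟩ ⟨hz, -⟩
    simpa using hball z hz
  refine (intervalIntegral.hasDerivAt_integral_of_dominated_loc_of_deriv_le
    (F := fun z t => F (z + t * Complex.I) * k t)
    (F' := fun z t => deriv F (z + t * Complex.I) * k t) (bound := fun _ => C)
    (Metric.ball_mem_nhds w hr) ?_ ?_ ?_ ?_ ?_ ?_).2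
  · filter_upwards [Metric.ball_mem_nhds w hr] with z hz
    exact ((continuous_line_of_continuousOn hF.continuousOn
      (hball z (Metric.ball_subset_closedBall hz))).mul hk).aestronglyMeasurable
  · exact ((continuous_line_of_continuousOn hF.continuousOn hw).mul hk).intervalIntegrable _ _
  · exact ((continuous_line_of_continuousOn hF' hw).mul hk).aestronglyMeasurable
  · refine Filter.Eventually.of_forall fun t ht z hz => hC (z, t) ⟨?_, Set.uIoc_subset_uIcc ht⟩
    exact Metric.ball_subset_closedBall hz
  · exact intervalIntegrable_const
  · refine Filter.Eventually.of_forall fun t _ z hz => ?_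
    have h1 : 0 < (z + t * Complex.I).re := by
      simpa using hball z (Metric.ball_subset_closedBall hz)
    have h2 := (hF.differentiableAt (isOpen_rightHalfPlane.mem_nhds h1)).hasDerivAt
    exact (h2.comp_add_const z (t * Complex.I)).mul_const _

theorem continuous_mk_line {F : ℂ → ℂ} (hF : ContinuousOn F {w | 0 < w.re})
    {x : ℝ} (hx : 0 < x) : Continuous fun y : ℝ => F ⟨x, y⟩ := by
  have h := continuous_line_of_continuousOn hF (w := x) (by simpa using hx)
  simpa only [Complex.mk_eq_add_mul_I] using h

theorem norm_linePairing_le {F : ℂ → ℂ} (hF : ContinuousOn F {w | 0 < w.re})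
    {k : ℝ → ℂ} (hk : Continuous k) (α β : ℝ) {w : ℂ} (hw : 0 < w.re) {M : ℝ} (hM : 0 ≤ M)
    (hFM : eLpNorm (fun y : ℝ => F ⟨w.re, y⟩) 2 volume ≤ ENNReal.ofReal M) :
    ‖linePairing F k α β w‖ ≤ M * l2NormOn k α β := by
  set μ := (volume : Measure ℝ).restrict (Set.uIoc α β) with hμ
  set u : ℝ → ℂ := fun t => F (w + t * Complex.I) with hu
  have huc : Continuous u := continuous_line_of_continuousOn hF hw
  have hline := continuous_mk_line hF hw
  have h1 : eLpNorm u 2 volume ≤ ENNReal.ofReal M := by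
    refine le_trans (le_of_eq ?_) hFM
    have e : u = (fun y : ℝ => F ⟨w.re, y⟩) ∘ fun t => t + w.im := by
      funext t
      simp only [hu, Function.comp]
      congr 1
      apply Complex.ext <;> simp [add_comm]
    rw [e]
    exact eLpNorm_comp_measurePreserving hline.aestronglyMeasurable
      (measurePreserving_add_right volume w.im)
  have h2 : ‖linePairing F k α β w‖ₑ ≤ ENNReal.ofReal M * eLpNorm k 2 μ := by
    have h3 : ‖linePairing F k α β w‖ₑ ≤ eLpNorm (u • k) 1 μ := by
      have e : ‖linePairing F k α β w‖ₑ = ‖∫ t in Set.uIoc α β, u t * k t‖ₑ := by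
        rw [← ofReal_norm, ← ofReal_norm, linePairing,
          intervalIntegral.norm_intervalIntegral_eq]
      rw [e, eLpNorm_one_eq_lintegral_enorm]
      exact enorm_integral_le_lintegral_enorm _
    refine h3.trans ((eLpNorm_smul_le_mul_eLpNorm hk.aestronglyMeasurable
      huc.aestronglyMeasurable (p := 2) (q := 2)).trans ?_)
    gcongr
    exact (eLpNorm_mono_measure u Measure.restrict_le_self).trans h1
  have h4 := ENNReal.toReal_mono
    (ENNReal.mul_ne_top ENNReal.ofReal_ne_top (memLp_uIoc_of_continuous hk α β).eLpNorm_ne_top) h2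
  rwa [ENNReal.toReal_mul, ENNReal.toReal_ofReal hM, toReal_enorm] at h4

section LineNorms

variable {F : ℂ → ℂ} (hF : DifferentiableOn ℂ F {w | 0 < w.re}) {A : ℝ} (hA : 0 ≤ A)
  (hFA : ∀ x : ℝ, 0 < x → eLpNorm (fun y : ℝ => F ⟨x, y⟩) 2 volume ≤ ENNReal.ofReal A)

theorem linePairing_ofReal (k : ℝ → ℂ) (α β x : ℝ) :
    linePairing F k α β x = ∫ t in α..β, F ⟨x, t⟩ * k t := by
  simp only [linePairing, Complex.mk_eq_add_mul_I]

include hF hA hFA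

/-- The mean-square norm on vertical lines decreases to the right: the pairings are bounded
holomorphic functions, to which the Phragmén–Lindelöf principle applies. -/
theorem eLpNorm_line_antitone {x₀ x M : ℝ} (hx₀ : 0 < x₀) (hx : x₀ ≤ x) (hM : 0 ≤ M)
    (h : eLpNorm (fun y : ℝ => F ⟨x₀, y⟩) 2 volume ≤ ENNReal.ofReal M) :
    eLpNorm (fun y : ℝ => F ⟨x, y⟩) 2 volume ≤ ENNReal.ofReal M := by
  refine eLpNorm_two_le_of_forall_pairing (continuous_mk_line hF.continuousOn
    (hx₀.trans_le hx)) hM fun R k _ hk => ?_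
  rw [← linePairing_ofReal]
  set Φ : ℂ → ℂ := fun z => linePairing F k (-R) R (z + x₀) with hΦ
  have hpos : ∀ z : ℂ, 0 ≤ z.re → 0 < (z + (x₀ : ℂ)).re := fun z hz => by
    simp only [Complex.add_re, Complex.ofReal_re]; linarith
  have hdiff : ∀ z : ℂ, 0 ≤ z.re → DifferentiableAt ℂ Φ z := fun z hz =>
    ((hasDerivAt_linePairing hF hk (-R) R (hpos z hz)).comp_add_const z _).differentiableAt
  have hbd : ∀ z : ℂ, 0 ≤ z.re → ‖Φ z‖ ≤ A * l2NormOn k (-R) R := fun z hz =>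
    norm_linePairing_le hF.continuousOn hk _ _ (hpos z hz) hA (hFA _ (hpos z hz))
  have hcl : closure {z : ℂ | 0 < z.re} = {z | 0 ≤ z.re} := Complex.closure_setOfPred_lt_re 0
  have hres := PhragmenLindelof.right_half_plane_of_bounded_on_real (f := Φ)
    (C := M * l2NormOn k (-R) R) (z := ((x - x₀ : ℝ) : ℂ)) ?_ ?_ ?_ ?_ ?_
  · simpa [hΦ] using hres
  · refine DifferentiableOn.diffContOnCl fun z hz => (hdiff z ?_).differentiableWithinAt
    rwa [hcl] at hz
  · refine ⟨1, by norm_num, 0, ?_⟩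
    refine Asymptotics.IsBigO.of_bound (A * l2NormOn k (-R) R) ?_
    refine Filter.Eventually.filter_mono inf_le_right ?_
    rw [Filter.eventually_principal]
    intro z hz
    simpa using hbd z (le_of_lt hz)
  · refine ⟨A * l2NormOn k (-R) R, ?_⟩
    rw [Filter.eventually_map]
    filter_upwards [Filter.eventually_ge_atTop 0] with t ht
    exact hbd t (by simpa using ht)
  · intro t
    refine norm_linePairing_le hF.continuousOn hk _ _ (hpos _ (by simp)) hM ?_
    simpa using h
  · simpa using hx

/-- The mean-square norm on vertical lines is log-convex, by the three lines theorem for the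
pairings. -/
theorem eLpNorm_line_logConvex {x d M₀ M₂ : ℝ} (hx : 0 < x) (hd : 0 < d) (hM₀ : 0 ≤ M₀)
    (hM₂ : 0 ≤ M₂) (h₀ : eLpNorm (fun y : ℝ => F ⟨x, y⟩) 2 volume ≤ ENNReal.ofReal M₀)
    (h₂ : eLpNorm (fun y : ℝ => F ⟨x + 2 * d, y⟩) 2 volume ≤ ENNReal.ofReal M₂) :
    eLpNorm (fun y : ℝ => F ⟨x + d, y⟩) 2 volume ≤ ENNReal.ofReal (√(M₂ * M₀)) := by
  refine eLpNorm_two_le_of_forall_pairing (continuous_mk_line hF.continuousOn (by linarith))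
    (Real.sqrt_nonneg _) fun R k _ hk => ?_
  rw [← linePairing_ofReal]
  set K := l2NormOn k (-R) R with hK
  have hK0 : 0 ≤ K := l2NormOn_nonneg _ _ _
  set Φ : ℂ → ℂ := linePairing F k (-R) R with hΦ
  have hdiff : ∀ z : ℂ, 0 < z.re → DifferentiableAt ℂ Φ z := fun z hz =>
    (hasDerivAt_linePairing hF hk (-R) R hz).differentiableAt
  have hbd : ∀ z : ℂ, 0 < z.re → ‖Φ z‖ ≤ A * K := fun z hz =>
    norm_linePairing_le hF.continuousOn hk _ _ hz hA (hFA _ hz)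
  have hlt : x < x + 2 * d := by linarith
  have hres := Complex.HadamardThreeLines.norm_le_interp_of_mem_verticalClosedStrip' (f := Φ)
    (l := x) (u := x + 2 * d) (z := ((x + d : ℝ) : ℂ)) (a := M₀ * K) (b := M₂ * K) hlt ?_ ?_ ?_ ?_ ?_
  · refine hres.trans (le_of_eq ?_)
    have e : ((((x + d : ℝ) : ℂ)).re - x) / (x + 2 * d - x) = 1 / 2 := by
      rw [Complex.ofReal_re]; field_simp; ring
    rw [e, show (1 - 1 / 2 : ℝ) = 1 / 2 by norm_num, ← Real.sqrt_eq_rpow, ← Real.sqrt_eq_rpow,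
      ← Real.sqrt_mul (by positivity), show M₀ * K * (M₂ * K) = M₂ * M₀ * K ^ 2 by ring,
      Real.sqrt_mul (by positivity), Real.sqrt_sq hK0]
  · constructor <;> rw [Complex.ofReal_re] <;> linarith
  · refine DifferentiableOn.diffContOnCl fun z hz => (hdiff z ?_).differentiableWithinAt
    have h1 : z ∈ Complex.re ⁻¹' Set.Icc x (x + 2 * d) := by
      rw [← closure_Ioo hlt.ne, ← Complex.closure_preimage_re]
      exact hz
    exact hx.trans_le h1.1
  · refine ⟨A * K, ?_⟩
    rintro _ ⟨z, hz, rfl⟩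
    exact hbd z (hx.trans_le hz.1)
  · intro z hz
    have hz' : z.re = x := hz
    exact norm_linePairing_le hF.continuousOn hk _ _ (by rw [hz']; exact hx) hM₀ (by rwa [hz'])
  · intro z hz
    have hz' : z.re = x + 2 * d := hz
    exact norm_linePairing_le hF.continuousOn hk _ _ (by rw [hz']; linarith) hM₂ (by rwa [hz'])

/-- Cauchy's estimate for the pairings. -/
theorem norm_deriv_linePairing_le {k : ℝ → ℂ} (hk : Continuous k) (α β : ℝ) {w : ℂ}
    (hw : 0 < w.re) :
    ‖deriv (linePairing F k α β) w‖ ≤ A * l2NormOn k α β / (w.re / 2) := by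
  have hr : 0 < w.re / 2 := by linarith
  have hball : ∀ z ∈ Metric.closedBall w (w.re / 2), 0 < z.re := fun z hz => by
    have h1 := Complex.abs_re_le_norm (z - w)
    rw [mem_closedBall_iff_norm] at hz
    have h2 := abs_le.mp (h1.trans hz)
    rw [Complex.sub_re] at h2
    linarith [h2.1]
  refine Complex.norm_deriv_le_of_forall_mem_sphere_norm_le hr ?_ fun z hz => ?_
  · refine DifferentiableOn.diffContOnCl fun z hz => ?_
    rw [closure_ball _ hr.ne'] at hz
    exact (hasDerivAt_linePairing hF hk α β (hball z hz)).differentiableAt.differentiableWithinAt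
  · have h1 := hball z (Metric.sphere_subset_closedBall hz)
    exact norm_linePairing_le hF.continuousOn hk _ _ h1 hA (hFA _ h1)

/-- Translating by `c` changes the function by `O(1 / x)` in mean square on the line `Re w = x`. -/
theorem eLpNorm_line_sub_translate_le {x : ℝ} (hx : 0 < x) {c : ℂ} (hc : 0 ≤ c.re) :
    eLpNorm (fun y : ℝ => F ⟨x, y⟩ - F (⟨x, y⟩ + c)) 2 volume ≤
      ENNReal.ofReal (2 * ‖c‖ * A / x) := by
  have hxc : 0 < ((x : ℂ) + c).re := by simp; linarith
  have hc1 := continuous_mk_line hF.continuousOn hx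
  have e1 : ∀ t : ℝ, (⟨x, t⟩ : ℂ) + c = (x + c) + t * Complex.I := fun t => by
    rw [Complex.mk_eq_add_mul_I]; ring
  have hc2 : Continuous fun y : ℝ => F (⟨x, y⟩ + c) := by
    simp only [e1]
    exact continuous_line_of_continuousOn hF.continuousOn hxc
  refine eLpNorm_two_le_of_forall_pairing (hc1.sub hc2) (by positivity) fun R k _ hk => ?_
  set Φ : ℂ → ℂ := linePairing F k (-R) R with hΦ
  have e2 : ∫ t in (-R)..R, (F ⟨x, t⟩ - F (⟨x, t⟩ + c)) * k t = Φ x - Φ (x + c) := by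
    simp only [sub_mul]
    have i1 : IntervalIntegrable (fun t => F ⟨x, t⟩ * k t) volume (-R) R :=
      (hc1.mul hk).intervalIntegrable _ _
    have i2 : IntervalIntegrable (fun t => F (⟨x, t⟩ + c) * k t) volume (-R) R :=
      (hc2.mul hk).intervalIntegrable _ _
    rw [intervalIntegral.integral_sub i1 i2, hΦ, linePairing_ofReal]
    simp only [e1, linePairing]
  change ‖∫ t in (-R)..R, (F ⟨x, t⟩ - F (⟨x, t⟩ + c)) * k t‖ ≤ _
  rw [e2]
  have hconv : Convex ℝ {z : ℂ | x ≤ z.re} := convex_halfSpace_re_ge x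
  have hmv := hconv.norm_image_sub_le_of_norm_deriv_le (𝕜 := ℂ) (f := Φ) (x := (x : ℂ) + c)
    (y := (x : ℂ)) (C := A * l2NormOn k (-R) R / (x / 2)) ?_ ?_ ?_ ?_
  · refine hmv.trans (le_of_eq ?_)
    rw [show (x : ℂ) - (x + c) = -c by ring, norm_neg]
    field_simp
  · intro z hz
    exact (hasDerivAt_linePairing hF hk _ _ (hx.trans_le hz)).differentiableAt
  · intro z hz
    have hz' : x ≤ z.re := hz
    refine (norm_deriv_linePairing_le hF hA hFA hk _ _ (hx.trans_le hz)).trans ?_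
    have := l2NormOn_nonneg k (-R) R
    gcongr
  · simpa using hc
  · simp

/-- Point evaluations are bounded: integrating `((1 - t) F (w + i t))'` over `[0, 1]` expresses
`F w` through two pairings. -/
theorem norm_apply_le_of_line_bound {w : ℂ} (hw : 0 < w.re) :
    ‖F w‖ ≤ A * (l2NormOn (fun _ => 1) 0 1 +
      l2NormOn (fun t => 1 - (t : ℂ)) 0 1 / (w.re / 2)) := by
  have hF' : ContinuousOn (deriv F) {w | 0 < w.re} :=
    (hF.deriv isOpen_rightHalfPlane).continuousOn
  set k₁ : ℝ → ℂ := fun _ => 1 with hk₁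
  set k₂ : ℝ → ℂ := fun t => 1 - (t : ℂ) with hk₂
  have hk₁c : Continuous k₁ := continuous_const
  have hk₂c : Continuous k₂ := by fun_prop
  have hd : ∀ t : ℝ, HasDerivAt (fun t : ℝ => F (w + t * Complex.I) * k₂ t)
      (Complex.I * (deriv F (w + t * Complex.I) * k₂ t) - F (w + t * Complex.I) * k₁ t) t := by
    intro t
    have h1 : 0 < (w + t * Complex.I).re := by simpa using hw
    have h2 := (hF.differentiableAt (isOpen_rightHalfPlane.mem_nhds h1)).hasDerivAt
    have h3 : HasDerivAt (fun t : ℝ => w + t * Complex.I) Complex.I t := by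
      simpa using ((Complex.ofRealCLM.hasDerivAt (x := t)).mul_const Complex.I).const_add w
    have h4 : HasDerivAt k₂ (-1) t := by
      simpa using (Complex.ofRealCLM.hasDerivAt (x := t)).const_sub (1 : ℂ)
    have h5 := (h2.comp t h3).mul h4
    convert! h5 using 1
    simp only [hk₁, Function.comp]
    ring
  have i1 : IntervalIntegrable (fun t : ℝ => deriv F (w + t * Complex.I) * k₂ t) volume 0 1 :=
    ((continuous_line_of_continuousOn hF' hw).mul hk₂c).intervalIntegrable _ _
  have i2 : IntervalIntegrable (fun t : ℝ => F (w + t * Complex.I) * k₁ t) volume 0 1 :=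
    ((continuous_line_of_continuousOn hF.continuousOn hw).mul hk₁c).intervalIntegrable _ _
  have hint := intervalIntegral.integral_eq_sub_of_hasDerivAt (a := 0) (b := 1)
    (fun t _ => hd t) ((i1.const_mul _).sub i2)
  rw [intervalIntegral.integral_sub (i1.const_mul _) i2,
    intervalIntegral.integral_const_mul] at hint
  have e : F w = linePairing F k₁ 0 1 w - Complex.I * deriv (linePairing F k₂ 0 1) w := by
    rw [(hasDerivAt_linePairing hF hk₂c 0 1 hw).deriv]
    simp only [linePairing]
    simp only [hk₂, Complex.ofReal_one, sub_self, mul_zero, Complex.ofReal_zero, zero_mul, add_zero,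
      sub_zero, mul_one, zero_sub] at hint ⊢
    linear_combination hint
  rw [e]
  refine (norm_sub_le _ _).trans ?_
  rw [norm_mul, Complex.norm_I, one_mul, mul_add, ← mul_div_assoc]
  exact add_le_add (norm_linePairing_le hF.continuousOn hk₁c _ _ hw hA (hFA _ hw))
    (norm_deriv_linePairing_le hF hA hFA hk₂c _ _ hw)

end LineNorms

/-! ### The Hardy space as a separable Hilbert space -/

namespace HardySpace

/-- The extension of a function in the Hardy space by zero to the whole plane. -/
noncomputable def extend (f : HardySpace) : ℂ → ℂ := by
  classical
  exact fun w => if h : 0 < w.re then f ⟨w, h⟩ else 0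

theorem extend_of_pos (f : HardySpace) {w : ℂ} (h : 0 < w.re) : f.extend w = f ⟨w, h⟩ :=
  dif_pos h

theorem extend_add (f g : HardySpace) (w : ℂ) : (f + g).extend w = f.extend w + g.extend w := by
  by_cases h : 0 < w.re
  · simp only [extend_of_pos _ h]; rfl
  · simp [extend, h]

theorem extend_smul (c : ℂ) (f : HardySpace) (w : ℂ) : (c • f).extend w = c * f.extend w := by
  by_cases h : 0 < w.re
  · simp only [extend_of_pos _ h]; rfl
  · simp [extend, h]

theorem extend_sub (f g : HardySpace) (w : ℂ) : (f - g).extend w = f.extend w - g.extend w := by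
  by_cases h : 0 < w.re
  · simp only [extend_of_pos _ h]; rfl
  · simp [extend, h]

theorem extend_zero (w : ℂ) : (0 : HardySpace).extend w = 0 := by
  rw [← sub_self (0 : HardySpace), extend_sub, sub_self]

theorem ext_of_extend {f g : HardySpace} (h : ∀ w : ℂ, 0 < w.re → f.extend w = g.extend w) :
    f = g := by
  refine Subtype.ext (funext fun w => ?_)
  have h1 := h w w.2
  rwa [extend_of_pos _ w.2, extend_of_pos _ w.2] at h1

theorem differentiableOn_extend (f : HardySpace) :
    DifferentiableOn ℂ f.extend {w | 0 < w.re} := by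
  obtain ⟨g, hg, hfg⟩ := f.isHolomorphic
  exact hg.congr fun w hw => by rw [extend_of_pos _ hw, hfg]

theorem continuousOn_extend (f : HardySpace) : ContinuousOn f.extend {w | 0 < w.re} :=
  f.differentiableOn_extend.continuousOn

theorem eLpNorm_extend_line_le (f : HardySpace) (x : ℝ) (hx : 0 < x) :
    eLpNorm (fun y : ℝ => f.extend ⟨x, y⟩) 2 volume ≤ ENNReal.ofReal ‖f‖ := by
  have e : (fun y : ℝ => f.extend ⟨x, y⟩) = fun y : ℝ => f (RightHalfPlane.mk x y hx) :=
    funext fun y => f.extend_of_pos (w := ⟨x, y⟩) hx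
  rw [e, norm_def, ENNReal.ofReal_toReal f.hardyENorm_lt_top.ne]
  exact le_iSup (fun x : {x : ℝ // 0 < x} =>
    eLpNorm (fun y : ℝ => f (RightHalfPlane.mk x.1 y x.2)) 2 volume) ⟨x, hx⟩

theorem norm_le_of_line {f : HardySpace} {M : ℝ} (hM : 0 ≤ M)
    (h : ∀ x : ℝ, 0 < x → eLpNorm (fun y : ℝ => f.extend ⟨x, y⟩) 2 volume ≤ ENNReal.ofReal M) :
    ‖f‖ ≤ M := by
  rw [norm_def]
  refine ENNReal.toReal_le_of_le_ofReal hM (iSup_le fun x => ?_)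
  have e : (fun y : ℝ => f (RightHalfPlane.mk x.1 y x.2)) = fun y : ℝ => f.extend ⟨x, y⟩ :=
    funext fun y => (f.extend_of_pos (w := ⟨x, y⟩) x.2).symm
  rw [e]
  exact h x.1 x.2

/-- The element of the Hardy space given by the restriction of `F` to the half-plane. -/
def ofBound (F : ℂ → ℂ) (hF : DifferentiableOn ℂ F {w | 0 < w.re}) (M : ℝ)
    (h : ∀ x : ℝ, 0 < x → eLpNorm (fun y : ℝ => F ⟨x, y⟩) 2 volume ≤ ENNReal.ofReal M) :
    HardySpace :=
  ⟨fun w => F w, ⟨F, hF, fun _ => rfl⟩, by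
    refine lt_of_le_of_lt (b := ENNReal.ofReal M) ?_ ENNReal.ofReal_lt_top
    unfold hardyENorm
    exact iSup_le fun x => h x.1 x.2⟩

theorem extend_ofBound {F : ℂ → ℂ} {hF : DifferentiableOn ℂ F {w | 0 < w.re}} {M : ℝ}
    {h : ∀ x : ℝ, 0 < x → eLpNorm (fun y : ℝ => F ⟨x, y⟩) 2 volume ≤ ENNReal.ofReal M}
    {w : ℂ} (hw : 0 < w.re) : (ofBound F hF M h).extend w = F w :=
  extend_of_pos _ hw

theorem aestronglyMeasurable_line (f : HardySpace) {x : ℝ} (hx : 0 < x) :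
    AEStronglyMeasurable (fun y : ℝ => f.extend ⟨x, y⟩) volume :=
  (continuous_mk_line f.continuousOn_extend hx).aestronglyMeasurable

/-- The constant in the pointwise estimate `|f w| ≤ C(Re w) ‖f‖`. -/
noncomputable def evalBound (x : ℝ) : ℝ :=
  l2NormOn (fun _ => 1) 0 1 + l2NormOn (fun t => 1 - (t : ℂ)) 0 1 / (x / 2)

theorem norm_extend_le (f : HardySpace) {w : ℂ} (hw : 0 < w.re) :
    ‖f.extend w‖ ≤ evalBound w.re * ‖f‖ := by
  rw [mul_comm]
  exact norm_apply_le_of_line_bound f.differentiableOn_extend (norm_nonneg f)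
    f.eLpNorm_extend_line_le hw

theorem evalBound_nonneg {x : ℝ} (hx : 0 < x) : 0 ≤ evalBound x :=
  add_nonneg (l2NormOn_nonneg _ _ _) (div_nonneg (l2NormOn_nonneg _ _ _) (by linarith))

theorem evalBound_anti {x y : ℝ} (hx : 0 < x) (hxy : x ≤ y) : evalBound y ≤ evalBound x := by
  unfold evalBound
  have := l2NormOn_nonneg (fun t => 1 - (t : ℂ)) 0 1
  gcongr

/-- Evaluation at a point of the half-plane. -/
noncomputable def evalCLM (w : RightHalfPlane) : HardySpace →L[ℂ] ℂ :=
  LinearMap.mkContinuous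
    { toFun := fun f => f w
      map_add' := fun _ _ => rfl
      map_smul' := fun _ _ => rfl } (evalBound w.1.re) fun f => by
    have h := f.norm_extend_le w.2
    rwa [extend_of_pos _ w.2] at h

theorem evalCLM_apply (w : RightHalfPlane) (f : HardySpace) : evalCLM w f = f w := rfl

instance : CompleteSpace HardySpace := by
  refine Metric.complete_of_cauchySeq_tendsto fun u hu => ?_
  have hu' := Metric.cauchySeq_iff.mp hu
  have hpt : ∀ w : ℂ, 0 < w.re →
      ∃ z, Filter.Tendsto (fun n => (u n).extend w) Filter.atTop (nhds z) := fun w hw => by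
    have h1 : CauchySeq fun n => evalCLM ⟨w, hw⟩ (u n) :=
      hu.map (evalCLM ⟨w, hw⟩).uniformContinuous
    obtain ⟨z, hz⟩ := cauchySeq_tendsto_of_complete h1
    exact ⟨z, by simpa only [extend_of_pos _ hw, evalCLM_apply] using hz⟩
  choose! G hG using hpt
  have hGd : DifferentiableOn ℂ G {w | 0 < w.re} := by
    intro w₀ hw₀
    have hw₀' : 0 < w₀.re := hw₀
    have hδ : 0 < w₀.re / 2 := by linarith
    have hopen : IsOpen {w : ℂ | w₀.re / 2 < w.re} :=
      isOpen_lt continuous_const Complex.continuous_re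
    have hunif : TendstoUniformlyOn (fun n => (u n).extend) G Filter.atTop
        {w : ℂ | w₀.re / 2 < w.re} := by
      rw [Metric.tendstoUniformlyOn_iff]
      intro ε hε
      have hC := evalBound_nonneg hδ
      obtain ⟨N, hN⟩ := hu' (ε / (2 * (evalBound (w₀.re / 2) + 1))) (by positivity)
      filter_upwards [Filter.eventually_ge_atTop N] with n hn w hw
      have hw' : w₀.re / 2 < w.re := hw
      have hwp : 0 < w.re := hδ.trans hw
      have h1 : ∀ m ≥ N, ‖(u m).extend w - (u n).extend w‖ ≤ ε / 2 := fun m hm => by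
        rw [← extend_sub]
        have h2 := hN m hm n hn
        rw [dist_eq_norm] at h2
        calc ‖(u m - u n).extend w‖ ≤ evalBound w.re * ‖u m - u n‖ := norm_extend_le _ hwp
          _ ≤ (evalBound (w₀.re / 2) + 1) * (ε / (2 * (evalBound (w₀.re / 2) + 1))) := by
            gcongr
            exact (evalBound_anti hδ hw'.le).trans (by linarith)
          _ = ε / 2 := by field_simp
      have h3 : ‖G w - (u n).extend w‖ ≤ ε / 2 :=
        le_of_tendsto ((hG w hwp).sub_const _).norm
          (Filter.eventually_atTop.mpr ⟨N, h1⟩)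
      rw [dist_eq_norm]
      linarith
    have hd : DifferentiableOn ℂ G {w : ℂ | w₀.re / 2 < w.re} :=
      hunif.tendstoLocallyUniformlyOn.differentiableOn
        (Filter.Eventually.of_forall fun n => (u n).differentiableOn_extend.mono
          fun w hw => hδ.trans hw) hopen
    have hmem : w₀.re / 2 < w₀.re := by linarith
    exact (hd.differentiableAt (hopen.mem_nhds hmem)).differentiableWithinAt
  -- By Fatou's lemma the convergence also takes place in the Hardy norm.
  have hfatou : ∀ ε > 0, ∃ N, ∀ n ≥ N, ∀ x : ℝ, 0 < x →
      eLpNorm (fun y : ℝ => G ⟨x, y⟩ - (u n).extend ⟨x, y⟩) 2 volume ≤ ENNReal.ofReal ε := by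
    intro ε hε
    obtain ⟨N, hN⟩ := hu' ε hε
    refine ⟨N, fun n hn x hx => ?_⟩
    refine (Lp.eLpNorm_lim_le_liminf_eLpNorm
      (f := fun m y => (u m).extend ⟨x, y⟩ - (u n).extend ⟨x, y⟩)
      (fun m => ((u m).aestronglyMeasurable_line hx).sub ((u n).aestronglyMeasurable_line hx)) _
      (Filter.Eventually.of_forall fun y => (hG ⟨x, y⟩ hx).sub_const _)).trans ?_
    refine Filter.liminf_le_of_frequently_le' (Filter.Eventually.frequently ?_)
    filter_upwards [Filter.eventually_ge_atTop N] with m hm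
    have h1 := (u m - u n).eLpNorm_extend_line_le x hx
    simp only [extend_sub] at h1
    refine h1.trans (ENNReal.ofReal_le_ofReal ?_)
    rw [← dist_eq_norm]
    exact (hN m hm n hn).le
  obtain ⟨N, hN⟩ := hfatou 1 one_pos
  have hGb : ∀ x : ℝ, 0 < x →
      eLpNorm (fun y : ℝ => G ⟨x, y⟩) 2 volume ≤ ENNReal.ofReal (1 + ‖u N‖) := fun x hx => by
    have e : (fun y : ℝ => G ⟨x, y⟩) = (fun y : ℝ => G ⟨x, y⟩ - (u N).extend ⟨x, y⟩)
        + fun y : ℝ => (u N).extend ⟨x, y⟩ := by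
      funext y; simp
    rw [e, ENNReal.ofReal_add zero_le_one (norm_nonneg _)]
    refine (eLpNorm_add_le ?_ ((u N).aestronglyMeasurable_line hx) (by norm_num)).trans
      (add_le_add (hN N le_rfl x hx) ((u N).eLpNorm_extend_line_le x hx))
    exact (continuous_mk_line hGd.continuousOn hx).aestronglyMeasurable.sub
      ((u N).aestronglyMeasurable_line hx)
  refine ⟨ofBound G hGd _ hGb, ?_⟩
  rw [Metric.tendsto_atTop]
  intro ε hε
  obtain ⟨N, hN⟩ := hfatou (ε / 2) (by linarith)
  refine ⟨N, fun n hn => ?_⟩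
  rw [dist_comm, dist_eq_norm]
  refine lt_of_le_of_lt (norm_le_of_line (M := ε / 2) (by linarith) fun x hx => ?_) (by linarith)
  have e : (fun y : ℝ => (ofBound G hGd _ hGb - u n).extend ⟨x, y⟩)
      = fun y : ℝ => G ⟨x, y⟩ - (u n).extend ⟨x, y⟩ := by
    funext y
    rw [extend_sub, extend_ofBound (w := ⟨x, y⟩) hx]
  rw [e]
  exact hN n hn x hx

theorem memLp_line (f : HardySpace) {x : ℝ} (hx : 0 < x) :
    MemLp (fun y : ℝ => f.extend ⟨x, y⟩) 2 volume :=
  ⟨f.aestronglyMeasurable_line hx,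
    (f.eLpNorm_extend_line_le x hx).trans_lt ENNReal.ofReal_lt_top⟩

/-- The norm is the limit, and not only the supremum, of the mean-square norms on the lines
`Re w = x` as `x → 0`. -/
theorem tendsto_line_norm (f : HardySpace) : Filter.Tendsto
    (fun x : ℝ => (eLpNorm (fun y : ℝ => f.extend ⟨x, y⟩) 2 volume).toReal)
    (nhdsWithin 0 (Set.Ioi 0)) (nhds ‖f‖) := by
  refine tendsto_order.mpr ⟨fun a ha => ?_, fun a ha => ?_⟩
  · rcases lt_or_ge a 0 with h0 | h0
    · exact Filter.Eventually.of_forall fun x => h0.trans_le ENNReal.toReal_nonneg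
    obtain ⟨x₁, hx₁, h1⟩ : ∃ x₁ : ℝ, 0 < x₁ ∧
        ¬ eLpNorm (fun y : ℝ => f.extend ⟨x₁, y⟩) 2 volume ≤ ENNReal.ofReal a := by
      by_contra! hcon
      exact absurd (norm_le_of_line h0 hcon) (not_le.mpr ha)
    filter_upwards [Ioo_mem_nhdsGT hx₁] with x hx
    by_contra! hle
    apply h1
    refine eLpNorm_line_antitone f.differentiableOn_extend (norm_nonneg f)
      f.eLpNorm_extend_line_le hx.1 hx.2.le h0 ?_
    exact (ENNReal.le_ofReal_iff_toReal_le (f.memLp_line hx.1).eLpNorm_ne_top h0).mpr hle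
  · filter_upwards [self_mem_nhdsWithin] with x hx
    exact lt_of_le_of_lt (ENNReal.toReal_le_of_le_ofReal (norm_nonneg f)
      (f.eLpNorm_extend_line_le x hx)) ha

theorem parallelogram_law (f g : HardySpace) :
    ‖f + g‖ * ‖f + g‖ + ‖f - g‖ * ‖f - g‖ = 2 * (‖f‖ * ‖f‖ + ‖g‖ * ‖g‖) := by
  have h1 := ((f + g).tendsto_line_norm.mul (f + g).tendsto_line_norm).add
    ((f - g).tendsto_line_norm.mul (f - g).tendsto_line_norm)
  have h2 := ((f.tendsto_line_norm.mul f.tendsto_line_norm).add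
    (g.tendsto_line_norm.mul g.tendsto_line_norm)).const_mul 2
  refine tendsto_nhds_unique_of_eventuallyEq h1 h2 ?_
  filter_upwards [self_mem_nhdsWithin] with x hx
  have hf := f.memLp_line hx
  have hg := g.memLp_line hx
  have h3 := parallelogram_law_with_norm ℂ (hf.toLp _) (hg.toLp _)
  rw [← MemLp.toLp_add, ← MemLp.toLp_sub, Lp.norm_toLp, Lp.norm_toLp, Lp.norm_toLp,
    Lp.norm_toLp] at h3
  simp only [extend_add, extend_sub, ← sq]
  exact h3

/-- The inner product of the Hardy space. -/
@[reducible]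
noncomputable def innerProductSpace : InnerProductSpace ℂ HardySpace :=
  InnerProductSpace.ofNorm ℂ parallelogram_law

end HardySpace

theorem separableSpace_of_separating_functionals {E : Type*} [NormedAddCommGroup E]
    [InnerProductSpace ℂ E] [CompleteSpace E] (φ : ℕ → E →L[ℂ] ℂ)
    (h : ∀ x, (∀ n, φ n x = 0) → x = 0) : TopologicalSpace.SeparableSpace E := by
  set r : ℕ → E := fun n => (InnerProductSpace.toDual ℂ E).symm (φ n) with hr
  set K : Submodule ℂ E := Submodule.span ℂ (Set.range r) with hK
  have hperp : Kᗮ = ⊥ := by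
    rw [Submodule.eq_bot_iff]
    intro x hx
    refine h x fun n => ?_
    have h1 := (Submodule.mem_orthogonal K x).mp hx (r n) (Submodule.subset_span ⟨n, rfl⟩)
    rwa [hr, InnerProductSpace.toDual_symm_apply] at h1
  have hdense := (Submodule.topologicalClosure_eq_top_iff (K := K)).mpr hperp
  have hsep : TopologicalSpace.IsSeparable (K : Set E) :=
    (Set.countable_range r).isSeparable.span
  have huniv : TopologicalSpace.IsSeparable (Set.univ : Set E) := by
    have h1 := hsep.closure
    rwa [← Submodule.topologicalClosure_coe, hdense] at h1
  exact TopologicalSpace.isSeparable_univ_iff.mp huniv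

namespace HardySpace

theorem exists_isometry_into_submodule (K : Submodule ℂ HardySpace)
    (hK : IsClosed (K : Set HardySpace)) (e : ℕ → HardySpace) (he : LinearIndependent ℂ e)
    (heK : ∀ n, e n ∈ K) : ∃ J : HardySpace →ₗᵢ[ℂ] HardySpace, ∀ x, J x ∈ K := by
  let _ := innerProductSpace
  have hsep : TopologicalSpace.SeparableSpace HardySpace := by
    have : Nonempty RightHalfPlane := ⟨⟨1, by simp⟩⟩
    refine separableSpace_of_separating_functionals
      (fun n => evalCLM (TopologicalSpace.denseSeq RightHalfPlane n)) fun f hf => ?_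
    have h1 : (f : RightHalfPlane → ℂ) = fun _ => 0 :=
      f.isHolomorphic.continuous.ext_on (TopologicalSpace.denseRange_denseSeq RightHalfPlane)
        continuous_const (by rintro _ ⟨n, rfl⟩; exact hf n)
    exact Subtype.ext h1
  have : CompleteSpace K := hK.completeSpace_coe
  have he' : LinearIndependent ℂ fun n => (⟨e n, heK n⟩ : K) :=
    LinearIndependent.of_comp K.subtype he
  obtain ⟨J⟩ := exists_linearIsometry_of_linearIndependent (E := HardySpace) _ he'
  exact ⟨K.subtypeₗᵢ.comp J, fun x => (J x).2⟩

end HardySpace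

/-! ### Composition operators with affine symbol -/

/-- A change of variables: composing with `w ↦ a w + b` maps the line `Re w = x` to the line
`Re w = a x + Re b`. -/
theorem eLpNorm_line_comp_affine {F : ℂ → ℂ} (hF : ContinuousOn F {w | 0 < w.re}) {a : ℝ}
    (ha : 0 < a) (b : ℂ) {x : ℝ} (hx : 0 < a * x + b.re) :
    eLpNorm (fun y : ℝ => F (a * ⟨x, y⟩ + b)) 2 volume =
      ENNReal.ofReal √a⁻¹ * eLpNorm (fun y : ℝ => F ⟨a * x + b.re, y⟩) 2 volume := by
  set G : ℝ → ℂ := fun y => F ⟨a * x + b.re, y⟩ with hG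
  have hGc : Continuous G := continuous_mk_line hF hx
  have e : (fun y : ℝ => F (a * ⟨x, y⟩ + b)) = (fun y => G (y + b.im)) ∘ fun y => a * y := by
    funext y
    simp only [Function.comp, hG]
    congr 1
    apply Complex.ext <;> simp
  have hGc' : Continuous fun y => G (y + b.im) := by fun_prop
  have e2 : eLpNorm (fun y => G (y + b.im)) 2 (volume : Measure ℝ) = eLpNorm G 2 volume :=
    eLpNorm_comp_measurePreserving hGc.aestronglyMeasurable
      (measurePreserving_add_right (volume : Measure ℝ) b.im)
  have hm : Measurable fun y : ℝ => a * y := by fun_prop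
  rw [e, ← eLpNorm_map_measure hGc'.aestronglyMeasurable hm.aemeasurable,
    Real.map_volume_mul_left ha.ne', eLpNorm_smul_measure_of_ne_top (by norm_num), e2, smul_eq_mul,
    abs_of_pos (inv_pos.mpr ha), Real.sqrt_eq_rpow,
    ENNReal.ofReal_rpow_of_pos (inv_pos.mpr ha)]
  norm_num

namespace HardySpace

variable {ψ : RightHalfPlane → RightHalfPlane} {hψ : IsAffineSelfMap ψ} {a : ℝ} {b : ℂ}

theorem extend_compositionOperator (h : ∀ w : RightHalfPlane, (ψ w : ℂ) = a * w + b)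
    (f : HardySpace) {w : ℂ} (hw : 0 < w.re) :
    (compositionOperator ψ hψ f).extend w = f.extend (a * w + b) := by
  have e := h ⟨w, hw⟩
  change (ψ ⟨w, hw⟩ : ℂ) = a * w + b at e
  rw [extend_of_pos _ hw, compositionOperator_apply, ← extend_of_pos f (ψ ⟨w, hw⟩).2, e]

theorem eLpNorm_compositionOperator_line (h : ∀ w : RightHalfPlane, (ψ w : ℂ) = a * w + b)
    (ha : 0 < a) (hb : 0 ≤ b.re) (f : HardySpace) {x : ℝ} (hx : 0 < x) :
    eLpNorm (fun y : ℝ => (compositionOperator ψ hψ f).extend ⟨x, y⟩) 2 volume =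
      ENNReal.ofReal √a⁻¹ * eLpNorm (fun y : ℝ => f.extend ⟨a * x + b.re, y⟩) 2 volume := by
  have e : (fun y : ℝ => (compositionOperator ψ hψ f).extend ⟨x, y⟩)
      = fun y : ℝ => f.extend (a * ⟨x, y⟩ + b) :=
    funext fun y => extend_compositionOperator h f (w := ⟨x, y⟩) hx
  rw [e]
  exact eLpNorm_line_comp_affine f.continuousOn_extend ha b (by positivity)

theorem norm_compositionOperator_apply_le (h : ∀ w : RightHalfPlane, (ψ w : ℂ) = a * w + b)
    (ha : 0 < a) (hb : 0 ≤ b.re) (f : HardySpace) : ‖compositionOperator ψ hψ f‖ ≤ √a⁻¹ * ‖f‖ := by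
  refine norm_le_of_line (by positivity) fun x hx => ?_
  rw [eLpNorm_compositionOperator_line h ha hb f hx, ENNReal.ofReal_mul (by positivity)]
  gcongr
  exact f.eLpNorm_extend_line_le _ (by positivity)

theorem norm_compositionOperator_of_re_eq_zero
    (h : ∀ w : RightHalfPlane, (ψ w : ℂ) = a * w + b) (ha : 0 < a) (hb : b.re = 0)
    (f : HardySpace) : ‖compositionOperator ψ hψ f‖ = √a⁻¹ * ‖f‖ := by
  refine le_antisymm (norm_compositionOperator_apply_le h ha hb.ge f) ?_
  have hs : 0 < √a⁻¹ := Real.sqrt_pos.mpr (inv_pos.mpr ha)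
  rw [← le_inv_mul_iff₀ hs]
  refine norm_le_of_line (by positivity) fun x hx => ?_
  have h1 := eLpNorm_compositionOperator_line (hψ := hψ) h ha hb.ge f (x := x / a) (by positivity)
  have h2 := (compositionOperator ψ hψ f).eLpNorm_extend_line_le (x / a) (by positivity)
  rw [h1, hb, add_zero, mul_div_cancel₀ _ ha.ne'] at h2
  rw [ENNReal.ofReal_mul (by positivity), ENNReal.ofReal_inv_of_pos hs, mul_comm, ← div_eq_mul_inv,
    ENNReal.le_div_iff_mul_le (Or.inl (by simpa using hs)) (Or.inl ENNReal.ofReal_ne_top), mul_comm]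
  exact h2

/-- If `a = 1` or `Re b = 0`, the operator is paranormal. -/
theorem compositionOperator_paranormal (h : ∀ w : RightHalfPlane, (ψ w : ℂ) = a * w + b)
    (ha : 0 < a) (hb : 0 ≤ b.re) (hab : a = 1 ∨ b.re = 0) (f : HardySpace) :
    ‖compositionOperator ψ hψ f‖ ^ 2 ≤
      ‖compositionOperator ψ hψ (compositionOperator ψ hψ f)‖ * ‖f‖ := by
  rcases hb.eq_or_lt with hb0 | hb0
  · rw [norm_compositionOperator_of_re_eq_zero h ha hb0.symm,
      norm_compositionOperator_of_re_eq_zero h ha hb0.symm,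
      norm_compositionOperator_of_re_eq_zero h ha hb0.symm]
    exact le_of_eq (by ring)
  obtain rfl : a = 1 := hab.resolve_right hb0.ne'
  set C := compositionOperator ψ hψ with hC
  have hnn : 0 ≤ ‖C (C f)‖ * ‖f‖ := by positivity
  have h1 : ‖C f‖ ≤ √(‖C (C f)‖ * ‖f‖) := by
    refine norm_le_of_line (Real.sqrt_nonneg _) fun x hx => ?_
    have e1 := eLpNorm_compositionOperator_line (hψ := hψ) h ha hb f hx
    have e2 := eLpNorm_compositionOperator_line (hψ := hψ) h ha hb (C f) hx
    have e3 := eLpNorm_compositionOperator_line (hψ := hψ) h ha hb f (x := 1 * x + b.re)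
      (by positivity)
    simp only [inv_one, Real.sqrt_one, ENNReal.ofReal_one, one_mul] at e1 e2 e3
    rw [hC, e1]
    refine eLpNorm_line_logConvex f.differentiableOn_extend (norm_nonneg f)
      f.eLpNorm_extend_line_le hx hb0 (norm_nonneg _) (norm_nonneg _)
      (f.eLpNorm_extend_line_le x hx) ?_
    rw [show x + 2 * b.re = x + b.re + b.re by ring, ← e3, ← hC, ← e2]
    exact (C (C f)).eLpNorm_extend_line_le x hx
  calc ‖C f‖ ^ 2 ≤ √(‖C (C f)‖ * ‖f‖) ^ 2 := by gcongr
    _ = _ := Real.sq_sqrt hnn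

/-- If `a < 1` and `Re b > 0`, the operator has no eigenvalues. On the vertical line through the
fixed point `p`, which `ψ` maps to itself, an eigenvector to the eigenvalue `μ` vanishes unless
`|μ| = a ^ (-1/2) > 1`, and in that case `f (ψⁿ w) = μⁿ f w` is unbounded unless `f w = 0`, although
`ψⁿ w` tends to `p`. -/
theorem eq_zero_of_compositionOperator_eq_smul (h : ∀ w : RightHalfPlane, (ψ w : ℂ) = a * w + b)
    (ha : 0 < a) (ha1 : a < 1) (hb : 0 < b.re) {μ : ℂ} {f : HardySpace}
    (hf : compositionOperator ψ hψ f = μ • f) : f = 0 := by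
  have h1a : 0 < 1 - a := by linarith
  have h1a' : (1 - a : ℂ) ≠ 0 := by exact_mod_cast h1a.ne'
  set F := f.extend with hFdef
  have hfun : ∀ w : ℂ, 0 < w.re → F (a * w + b) = μ * F w := fun w hw => by
    rw [hFdef, ← extend_compositionOperator (hψ := hψ) h f hw, hf, extend_smul]
  have hfin : (∀ w : ℂ, 0 < w.re → F w = 0) → f = 0 := fun h0 =>
    ext_of_extend fun w hw => by
      rw [← hFdef, h0 w hw, extend_zero]
  set p : ℂ := b / (1 - a) with hp
  have hpre : p.re = b.re / (1 - a) := by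
    rw [hp, show (1 - a : ℂ) = ((1 - a : ℝ) : ℂ) by push_cast; ring, Complex.div_ofReal_re]
  have hp0 : 0 < p.re := by rw [hpre]; positivity
  have hfix : a * p.re + b.re = p.re := by rw [hpre]; field_simp; ring
  set L := eLpNorm (fun y : ℝ => F ⟨p.re, y⟩) 2 volume with hL
  have hLtop : L ≠ ∞ := (f.memLp_line hp0).eLpNorm_ne_top
  have hLeq : ‖μ‖ₑ * L = ENNReal.ofReal √a⁻¹ * L := by
    have e1 := eLpNorm_compositionOperator_line (hψ := hψ) h ha hb.le f hp0
    rw [hfix] at e1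
    rw [hL, ← e1, hf, ← eLpNorm_const_smul]
    congr 1
    funext y
    simp [extend_smul, hFdef]
  rcases eq_or_ne L 0 with hL0 | hL0
  · refine hfin ?_
    have hc := continuous_mk_line f.continuousOn_extend hp0
    rw [hL, eLpNorm_eq_zero_iff hc.aestronglyMeasurable (by norm_num)] at hL0
    have hline : ∀ y : ℝ, F ⟨p.re, y⟩ = 0 :=
      congrFun ((hc.ae_eq_iff_eq volume continuous_zero).mp hL0)
    have han : AnalyticOnNhd ℂ F {w | 0 < w.re} :=
      f.differentiableOn_extend.analyticOnNhd isOpen_rightHalfPlane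
    have hfreq : ∃ᶠ z in nhdsWithin p {p}ᶜ, F z = 0 := by
      have ht : Filter.Tendsto (fun y : ℝ => (⟨p.re, y⟩ : ℂ)) (nhdsWithin p.im {p.im}ᶜ)
          (nhdsWithin p {p}ᶜ) := by
        refine tendsto_nhdsWithin_of_tendsto_nhds_of_eventually_within _ ?_ ?_
        · have hcont : Continuous fun y : ℝ => (⟨p.re, y⟩ : ℂ) := by
            simp only [Complex.mk_eq_add_mul_I]; fun_prop
          exact (hcont.tendsto p.im).mono_left nhdsWithin_le_nhds
        · filter_upwards [self_mem_nhdsWithin] with y hy heq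
          exact hy (congrArg Complex.im heq)
      exact ht.frequently (Filter.Frequently.of_forall hline)
    intro w hw
    exact han.eqOn_zero_of_preconnected_of_frequently_eq_zero
      (convex_halfSpace_re_gt 0).isPreconnected hp0 hfreq hw
  · have hμ : ‖μ‖ₑ = ENNReal.ofReal √a⁻¹ := (ENNReal.mul_left_inj hL0 hLtop).mp hLeq
    have hμ1 : 1 < ‖μ‖ := by
      have : ‖μ‖ = √a⁻¹ := by
        rw [← toReal_enorm, hμ, ENNReal.toReal_ofReal (Real.sqrt_nonneg _)]
      rw [this]
      exact Real.lt_sqrt_of_sq_lt (by rw [one_pow]; exact (one_lt_inv₀ ha).mpr ha1)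
    refine hfin fun w hw => ?_
    have hit : ∀ n : ℕ, 0 < (p + (a : ℂ) ^ n * (w - p)).re ∧
        F (p + (a : ℂ) ^ n * (w - p)) = μ ^ n * F w := by
      intro n
      induction n with
      | zero => simpa using hw
      | succ n ih =>
        have e : p + (a : ℂ) ^ (n + 1) * (w - p)
            = a * (p + (a : ℂ) ^ n * (w - p)) + b := by
          have : b = (1 - a) * p := by rw [hp]; field_simp
          rw [this]; ring
        rw [e]
        refine ⟨?_, by rw [hfun _ ih.1, ih.2]; ring⟩
        rw [Complex.add_re, Complex.re_ofReal_mul]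
        have := mul_pos ha ih.1
        linarith
    have hlim : Filter.Tendsto (fun n : ℕ => p + (a : ℂ) ^ n * (w - p)) Filter.atTop (nhds p) := by
      have h1 : Filter.Tendsto (fun n : ℕ => (a : ℂ) ^ n) Filter.atTop (nhds 0) :=
        tendsto_pow_atTop_nhds_zero_of_norm_lt_one (by
          rw [Complex.norm_real, Real.norm_of_nonneg ha.le]; exact ha1)
      simpa using (h1.mul_const (w - p)).const_add p
    have hFp : ContinuousAt F p :=
      f.continuousOn_extend.continuousAt (isOpen_rightHalfPlane.mem_nhds hp0)
    have h2 := (hFp.tendsto.comp hlim).norm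
    by_contra hne
    have h3 : Filter.Tendsto (fun n : ℕ => ‖μ‖ ^ n * ‖F w‖) Filter.atTop Filter.atTop :=
      (tendsto_pow_atTop_atTop_of_one_lt hμ1).atTop_mul_const (norm_pos_iff.mpr hne)
    refine not_tendsto_nhds_of_tendsto_atTop h3 _ (h2.congr fun n => ?_)
    simp only [Function.comp, (hit n).2, norm_mul, norm_pow]

end HardySpace

/-! ### The quasi-periodic functions `ζᵏ / (w + q)` -/

/-- The function `exp (2 π i log u / log a)` of `u = w + q`, invariant under `u ↦ a u`. -/
noncomputable def logPeriodic (a : ℝ) (q w : ℂ) : ℂ :=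
  Complex.exp (2 * Real.pi * Complex.I * (Complex.log (w + q) / Real.log a))

section Kernel

variable {a : ℝ} {q : ℂ}

theorem mem_slitPlane_add (hq : 0 < q.re) {w : ℂ} (hw : 0 < w.re) :
    w + q ∈ Complex.slitPlane :=
  Or.inl (by rw [Complex.add_re]; linarith)

theorem logPeriodic_scale (ha : 1 < a) (hq : 0 < q.re) {w w' : ℂ} (hw : 0 < w.re)
    (h : w' + q = a * (w + q)) : logPeriodic a q w' = logPeriodic a q w := by
  have hl : (Real.log a : ℂ) ≠ 0 := by exact_mod_cast (Real.log_pos ha).ne'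
  have h1 := Complex.log_ofReal_mul (zero_lt_one.trans ha)
    (Complex.slitPlane_ne_zero (mem_slitPlane_add hq hw))
  unfold logPeriodic
  rw [h, h1, add_div, div_self hl, mul_add, mul_one, Complex.exp_add, Complex.exp_two_pi_mul_I,
    one_mul]

theorem norm_logPeriodic_le (ha : 1 < a) (w : ℂ) :
    ‖logPeriodic a q w‖ ≤ Real.exp (2 * Real.pi * (Real.pi / Real.log a)) := by
  have hl := Real.log_pos ha
  rw [logPeriodic, Complex.norm_exp]
  have e : (2 * Real.pi * Complex.I * (Complex.log (w + q) / Real.log a)).re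
      = 2 * Real.pi * (-(Complex.log (w + q)).im / Real.log a) := by
    rw [show 2 * Real.pi * Complex.I * (Complex.log (w + q) / Real.log a)
      = ((2 * Real.pi : ℝ) : ℂ) * ((Complex.I * Complex.log (w + q)) / (Real.log a : ℝ)) by
        push_cast; ring, Complex.re_ofReal_mul, Complex.div_ofReal_re, Complex.I_mul_re]
  rw [e]
  have := Complex.neg_pi_lt_log_im (w + q)
  have := Real.pi_pos
  gcongr
  linarith

theorem differentiableOn_logPeriodic (hq : 0 < q.re) :
    DifferentiableOn ℂ (logPeriodic a q) {w | 0 < w.re} := by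
  intro w hw
  have h1 : DifferentiableAt ℂ (fun w => Complex.log (w + q)) w :=
    (differentiableAt_id.add_const q).clog (mem_slitPlane_add hq hw)
  exact (((h1.div_const _).const_mul _).cexp).differentiableWithinAt

theorem exists_line_bound_inv (hq : 0 < q.re) : ∃ g : ℝ → ℝ, MemLp g 2 volume ∧
    ∀ x : ℝ, 0 < x → ∀ y : ℝ, ‖((⟨x, y⟩ : ℂ) + q)⁻¹‖ ≤ g y := by
  set m := min q.re 1 with hm
  have hm0 : 0 < m := lt_min hq one_pos
  set g₀ : ℝ → ℝ := fun y => (√(1 + (y + q.im) ^ 2))⁻¹ with hg₀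
  have hpos : ∀ y : ℝ, 0 < 1 + (y + q.im) ^ 2 := fun y => by positivity
  have hgc : Continuous g₀ :=
    Continuous.inv₀ (by fun_prop) fun y => (Real.sqrt_pos.mpr (hpos y)).ne'
  refine ⟨fun y => m⁻¹ * g₀ y, ?_, fun x hx y => ?_⟩
  · refine MemLp.const_mul ?_ _
    rw [memLp_two_iff_integrable_sq hgc.aestronglyMeasurable]
    refine (integrable_inv_one_add_sq.comp_add_right q.im).congr
      (Filter.Eventually.of_forall fun y => ?_)
    simp only [hg₀, inv_pow, Real.sq_sqrt (hpos y).le]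
  · rw [norm_inv, hg₀]
    simp only
    rw [← mul_inv]
    have hs := Real.sqrt_pos.mpr (hpos y)
    refine inv_anti₀ (by positivity) ?_
    rw [← abs_of_pos (mul_pos hm0 hs), ← abs_norm, ← sq_le_sq, mul_pow, Real.sq_sqrt (hpos y).le,
      ← Complex.normSq_eq_norm_sq, Complex.normSq_apply]
    simp only [Complex.add_re, Complex.add_im]
    have h1 : m ≤ q.re := min_le_left _ _
    have h2 : m ≤ 1 := min_le_right _ _
    have h3 : m ^ 2 ≤ 1 := by nlinarith
    have h4 : m ^ 2 ≤ (x + q.re) ^ 2 := by gcongr; linarith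
    nlinarith [mul_nonneg (sub_nonneg.mpr h3) (sq_nonneg (y + q.im))]

theorem exists_line_bound_logPeriodic (ha : 1 < a) (hq : 0 < q.re) (k : ℕ) :
    ∃ M : ℝ, ∀ x : ℝ, 0 < x →
      eLpNorm (fun y : ℝ => ((⟨x, y⟩ : ℂ) + q)⁻¹ * logPeriodic a q ⟨x, y⟩ ^ k) 2 volume ≤
        ENNReal.ofReal M := by
  obtain ⟨g, hg, hgb⟩ := exists_line_bound_inv hq
  set B := Real.exp (2 * Real.pi * (Real.pi / Real.log a))
  have hg' := hg.mul_const (B ^ k)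
  refine ⟨(eLpNorm (fun y => g y * B ^ k) 2 volume).toReal, fun x hx => ?_⟩
  rw [ENNReal.ofReal_toReal hg'.eLpNorm_ne_top]
  refine eLpNorm_mono_real fun y => ?_
  rw [norm_mul, norm_pow]
  have h1 := hgb x hx y
  have h2 := norm_logPeriodic_le (q := q) ha ⟨x, y⟩
  have h3 := (norm_nonneg _).trans h1
  gcongr

/-- The function `ζᵏ / (w + q)`, where `ζ` is `logPeriodic a q`, as an element of the Hardy
space. -/
noncomputable def quasiPeriodic (ha : 1 < a) (hq : 0 < q.re) (k : ℕ) : HardySpace :=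
  HardySpace.ofBound (fun w => (w + q)⁻¹ * logPeriodic a q w ^ k)
    (by
      refine DifferentiableOn.mul ?_ ((differentiableOn_logPeriodic hq).pow k)
      exact DifferentiableOn.inv (by fun_prop) fun w hw =>
        Complex.slitPlane_ne_zero (mem_slitPlane_add hq hw))
    (exists_line_bound_logPeriodic ha hq k).choose
    (exists_line_bound_logPeriodic ha hq k).choose_spec

theorem extend_quasiPeriodic (ha : 1 < a) (hq : 0 < q.re) (k : ℕ) {w : ℂ} (hw : 0 < w.re) :
    (quasiPeriodic ha hq k).extend w = (w + q)⁻¹ * logPeriodic a q w ^ k :=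
  HardySpace.extend_ofBound hw

theorem infinite_image_logPeriodic (ha : 1 < a) (q : ℂ) :
    (logPeriodic a q '' {w | 0 < w.re}).Infinite := by
  have hl := Real.log_pos ha
  have hl' : (Real.log a : ℂ) ≠ 0 := by exact_mod_cast hl.ne'
  set τ : ℝ := |q.re| with hτ
  -- The points with `w + q = exp (τ + t log a)`, `0 < t < 1`, have distinct images on a circle.
  set γ : ℝ → ℂ := fun t => Real.exp (τ + t * Real.log a) - q with hγ
  have hval : ∀ t : ℝ, logPeriodic a q (γ t)
      = Complex.exp (2 * Real.pi * Complex.I * (τ / Real.log a + t)) := fun t => by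
    rw [logPeriodic, hγ]
    simp only [sub_add_cancel]
    rw [← Complex.ofReal_log (Real.exp_pos _).le, Real.log_exp]
    congr 2
    push_cast
    field_simp
  have hinj : Set.InjOn (logPeriodic a q ∘ γ) (Set.Ioo 0 1) := by
    intro s hs t ht hst
    simp only [Function.comp, hval] at hst
    obtain ⟨n, hn⟩ := Complex.exp_eq_exp_iff_exists_int.mp hst
    have hpi : (2 * Real.pi * Complex.I : ℂ) ≠ 0 := Complex.two_pi_I_ne_zero
    have h1 : (2 * Real.pi * Complex.I : ℂ) * s = 2 * Real.pi * Complex.I * (t + n) := by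
      linear_combination hn
    have h2 : s = t + n := by exact_mod_cast mul_left_cancel₀ hpi h1
    have h3 : -1 < (n : ℝ) := by linarith [hs.1, ht.2]
    have h4 : (n : ℝ) < 1 := by linarith [hs.2, ht.1]
    have h5 : -1 < n := by exact_mod_cast h3
    have h6 : n < 1 := by exact_mod_cast h4
    obtain rfl : n = 0 := by omega
    simpa using h2
  refine ((Set.Ioo_infinite (zero_lt_one (α := ℝ))).image hinj).mono ?_
  rintro _ ⟨t, ht, rfl⟩
  refine ⟨γ t, ?_, rfl⟩
  have h1 : 0 < t * Real.log a := mul_pos ht.1 hl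
  have h2 := Real.add_one_le_exp (τ + t * Real.log a)
  have h3 := le_abs_self q.re
  change 0 < (γ t).re
  simp only [hγ, Complex.sub_re, Complex.ofReal_re]
  linarith

theorem linearIndependent_quasiPeriodic (ha : 1 < a) (hq : 0 < q.re) :
    LinearIndependent ℂ (quasiPeriodic ha hq) := by
  rw [linearIndependent_iff']
  intro s c hc i hi
  set P : Polynomial ℂ := ∑ k ∈ s, Polynomial.monomial k (c k) with hP
  have hroot : ∀ z ∈ logPeriodic a q '' {w | 0 < w.re}, P.IsRoot z := by
    rintro _ ⟨w, hw, rfl⟩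
    have hw' : 0 < w.re := hw
    have h1 := congrArg (HardySpace.evalCLM ⟨w, hw'⟩) hc
    rw [map_sum, map_zero] at h1
    have h2 : ∀ k, HardySpace.evalCLM ⟨w, hw'⟩ (c k • quasiPeriodic ha hq k)
        = (w + q)⁻¹ * (c k * logPeriodic a q w ^ k) := fun k => by
      rw [map_smul, HardySpace.evalCLM_apply, ← HardySpace.extend_of_pos _ hw',
        extend_quasiPeriodic ha hq k hw', smul_eq_mul]
      ring
    simp only [h2] at h1
    rw [← Finset.mul_sum, mul_eq_zero, inv_eq_zero] at h1
    have h3 := h1.resolve_left (Complex.slitPlane_ne_zero (mem_slitPlane_add hq hw'))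
    rw [Polynomial.IsRoot, hP, Polynomial.eval_finsetSum]
    simpa only [Polynomial.eval_monomial] using h3
  have hP0 : P = 0 := Polynomial.eq_zero_of_infinite_isRoot P
    ((infinite_image_logPeriodic ha q).mono hroot)
  have h4 : P.coeff i = c i := by
    rw [hP, Polynomial.finsetSum_coeff]
    simp [Polynomial.coeff_monomial, hi]
  rw [← h4, hP0, Polynomial.coeff_zero]

end Kernel

/-! ### The characterization of universality -/

/-- The affine self-map `w ↦ a w + b` of the half-plane. -/
def affineMap (a : ℝ) (b : ℂ) (ha : 0 < a) (hb : 0 ≤ b.re) (w : RightHalfPlane) :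
    RightHalfPlane :=
  ⟨a * w + b, by
    rw [Complex.add_re, Complex.re_ofReal_mul]
    have := mul_pos ha w.2
    linarith⟩

theorem isAffineSelfMap_affineMap {a : ℝ} {b : ℂ} (ha : 0 < a) (hb : 0 ≤ b.re) :
    IsAffineSelfMap (affineMap a b ha hb) :=
  ⟨a, b, by exact_mod_cast ha.ne', fun _ => rfl⟩

/-- The composition operator with symbol `w ↦ a w + b`. -/
noncomputable def affineComp (a : ℝ) (b : ℂ) (ha : 0 < a) (hb : 0 ≤ b.re) :
    HardySpace →L[ℂ] HardySpace :=
  compositionOperator (affineMap a b ha hb) (isAffineSelfMap_affineMap ha hb)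

namespace HardySpace

theorem extend_affineComp {a : ℝ} {b : ℂ} (ha : 0 < a) (hb : 0 ≤ b.re) (f : HardySpace) {w : ℂ}
    (hw : 0 < w.re) : (affineComp a b ha hb f).extend w = f.extend (a * w + b) :=
  extend_compositionOperator (fun _ => rfl) f hw

theorem norm_affineComp_le {a : ℝ} {b : ℂ} (ha : 0 < a) (hb : 0 ≤ b.re) :
    ‖affineComp a b ha hb‖ ≤ √a⁻¹ :=
  ContinuousLinearMap.opNorm_le_bound _ (Real.sqrt_nonneg _)
    (norm_compositionOperator_apply_le (fun _ => rfl) ha hb)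

variable {ψ : RightHalfPlane → RightHalfPlane} {hψ : IsAffineSelfMap ψ} {a : ℝ} {b : ℂ}

/-- Written with the fixed point `-q` of `ψ`, the iterates are `ψⁿ w = aⁿ (w + q) - q`. -/
theorem extend_compositionOperator_pow (h : ∀ w : RightHalfPlane, (ψ w : ℂ) = a * w + b)
    (ha : 1 < a) {q : ℂ} (hq : 0 < q.re) (hbq : b = (a - 1) * q) (f : HardySpace) (n : ℕ) :
    ∀ w : ℂ, 0 < w.re → ((compositionOperator ψ hψ ^ n) f).extend w =
      f.extend ((a ^ n : ℝ) * w + (a ^ n - 1 : ℝ) * q) := by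
  induction n with
  | zero => intro w _; simp
  | succ n ih =>
    intro w hw
    have h1 : 0 < (a * w + b).re := by
      rw [hbq, ← Complex.ofReal_one, ← Complex.ofReal_sub, Complex.add_re, Complex.re_ofReal_mul,
        Complex.re_ofReal_mul]
      have := mul_pos (zero_lt_one.trans ha) hw
      have := mul_pos (sub_pos.mpr ha) hq
      linarith
    rw [pow_succ', mul_apply_eq_comp, extend_compositionOperator h _ hw, ih _ h1, hbq]
    congr 1
    push_cast
    ring

/-- On the range of `1 - D`, where `D` is the translation by `q`, the powers of `C` decay faster by
the factor `a⁻ⁿ`: they look at `f - D f` only on the half-plane `Re w ≥ (aⁿ - 1) Re q`, where it is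
`O(a⁻ⁿ)`. -/
theorem norm_compositionOperator_pow_mul_le (h : ∀ w : RightHalfPlane, (ψ w : ℂ) = a * w + b)
    (ha : 1 < a) {q : ℂ} (hq : 0 < q.re) (hbq : b = (a - 1) * q) (n : ℕ) :
    ‖compositionOperator ψ hψ ^ (n + 1) * (1 - affineComp 1 q one_pos hq.le)‖ ≤
      √(a ^ (n + 1))⁻¹ * (2 * ‖q‖ / (q.re * (1 - a⁻¹)) * (a ^ (n + 1))⁻¹) := by
  have ha0 : 0 < a := zero_lt_one.trans ha
  have hinv : 0 < 1 - a⁻¹ := sub_pos.mpr (inv_lt_one_of_one_lt₀ ha)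
  set r := a ^ (n + 1) with hr
  have hr0 : 0 < r := by positivity
  have hr1 : 0 < r - 1 := sub_pos.mpr (one_lt_pow₀ ha n.succ_ne_zero)
  refine ContinuousLinearMap.opNorm_le_bound _ (by positivity) fun f => ?_
  refine norm_le_of_line (by positivity) fun x hx => ?_
  set g := f - affineComp 1 q one_pos hq.le f with hg
  have hbre : (((r - 1 : ℝ) : ℂ) * q).re = (r - 1) * q.re := Complex.re_ofReal_mul _ _
  set X := r * x + (r - 1) * q.re with hX
  have hXlow : r * ((1 - a⁻¹) * q.re) ≤ X := by
    have h1 : r * a⁻¹ = a ^ n := by rw [hr, pow_succ]; field_simp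
    have h2 : 1 ≤ a ^ n := one_le_pow₀ ha.le
    have h3 : r * ((1 - a⁻¹) * q.re) = (r - a ^ n) * q.re := by rw [← h1]; ring
    have h4 : (r - a ^ n) * q.re ≤ (r - 1) * q.re := by gcongr
    have := mul_pos hr0 hx
    linarith
  have hXpos : 0 < X := lt_of_lt_of_le (by positivity) hXlow
  have e : (fun y : ℝ => ((compositionOperator ψ hψ ^ (n + 1) *
      (1 - affineComp 1 q one_pos hq.le)) f).extend ⟨x, y⟩)
      = fun y : ℝ => g.extend ((r : ℝ) * ⟨x, y⟩ + (r - 1 : ℝ) * q) := by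
    funext y
    rw [mul_apply_eq_comp, extend_compositionOperator_pow h ha hq hbq _ _ ⟨x, y⟩ hx]
    rfl
  have e2 : (fun y : ℝ => g.extend ⟨X, y⟩)
      = fun y : ℝ => f.extend ⟨X, y⟩ - f.extend (⟨X, y⟩ + q) := by
    funext y
    rw [hg, extend_sub, extend_affineComp one_pos hq.le f (w := ⟨X, y⟩) hXpos]
    simp
  rw [e, eLpNorm_line_comp_affine g.continuousOn_extend hr0 _ (by rw [hbre]; exact hXpos), hbre,
    ← hX, e2, mul_assoc, ENNReal.ofReal_mul (by positivity)]
  gcongr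
  refine (eLpNorm_line_sub_translate_le f.differentiableOn_extend (norm_nonneg f)
    f.eLpNorm_extend_line_le hXpos hq.le).trans (ENNReal.ofReal_le_ofReal ?_)
  calc 2 * ‖q‖ * ‖f‖ / X ≤ 2 * ‖q‖ * ‖f‖ / (r * ((1 - a⁻¹) * q.re)) := by gcongr
    _ = 2 * ‖q‖ / (q.re * (1 - a⁻¹)) * r⁻¹ * ‖f‖ := by field_simp

/-- For `a > 1` and `Re b > 0` the operator `C_ψ - a⁻¹` has a right inverse. The translation `D` by
`q` splits the identity into `D`, on whose range `C_ψ` can be inverted, and `1 - D`. -/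
theorem exists_rightInverse_compositionOperator
    (h : ∀ w : RightHalfPlane, (ψ w : ℂ) = a * w + b) (ha : 1 < a) {q : ℂ} (hq : 0 < q.re)
    (hbq : b = (a - 1) * q) : ∃ S : HardySpace →L[ℂ] HardySpace, ∀ x,
      (compositionOperator ψ hψ - ((a : ℂ)⁻¹) • ContinuousLinearMap.id ℂ HardySpace) (S x) = x := by
  have ha0 : 0 < a := zero_lt_one.trans ha
  have hac : (a : ℂ) ≠ 0 := by exact_mod_cast ha0.ne'
  have hnc : ‖(a : ℂ)‖ = a := by rw [Complex.norm_real, Real.norm_of_nonneg ha0.le]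
  -- Both series are dominated by the geometric series with ratio `ρ = a ^ (-1/2)`.
  set ρ := √a⁻¹ with hρ
  have hρ0 : 0 < ρ := Real.sqrt_pos.mpr (inv_pos.mpr ha0)
  have hρ1 : ρ < 1 := by
    rw [hρ, Real.sqrt_lt' one_pos, one_pow]; exact inv_lt_one_of_one_lt₀ ha
  have hρa : a⁻¹ = ρ ^ 2 := (Real.sq_sqrt (inv_nonneg.mpr ha0.le)).symm
  have hgeo : Summable fun n : ℕ => ρ ^ n := summable_geometric_of_lt_one hρ0.le hρ1
  have hrpos : ∀ n : ℕ, 0 < (a⁻¹) ^ (n + 1) := fun n => by positivity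
  have hre : ∀ n : ℕ, 0 ≤ ((((a⁻¹) ^ (n + 1) : ℝ) : ℂ) * q).re := fun n => by
    rw [Complex.re_ofReal_mul]; exact (mul_pos (hrpos n) hq).le
  have hCre : ∀ w : ℂ, 0 < w.re → 0 < (a * w + b).re := fun w hw => by
    rw [hbq, ← Complex.ofReal_one, ← Complex.ofReal_sub, Complex.add_re, Complex.re_ofReal_mul,
      Complex.re_ofReal_mul]
    have := mul_pos ha0 hw
    have := mul_pos (sub_pos.mpr ha) hq
    linarith
  refine exists_rightInverse_sub_smul (compositionOperator ψ hψ) (affineComp 1 q one_pos hq.le)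
    (fun n => affineComp ((a⁻¹) ^ (n + 1)) (((a⁻¹) ^ (n + 1) : ℝ) * q) (hrpos n) (hre n))
    (inv_ne_zero hac) ?_ (fun n => ?_) ?_ ?_
  · ext1 f
    refine ext_of_extend fun w hw => ?_
    rw [mul_apply_eq_comp, extend_compositionOperator h _ hw,
      extend_affineComp _ _ _ (hCre w hw), extend_affineComp _ _ _ hw, hbq]
    congr 1
    push_cast
    field_simp
    ring
  · ext1 f
    refine ext_of_extend fun w hw => ?_
    rw [mul_apply_eq_comp, extend_compositionOperator h _ hw,
      extend_affineComp _ _ _ (hCre w hw), extend_affineComp _ _ _ hw, hbq]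
    congr 1
    have ht : (a : ℂ) * ((a : ℂ)⁻¹) ^ (n + 1 + 1) = ((a : ℂ)⁻¹) ^ (n + 1) := by
      rw [pow_succ', mul_inv_cancel_left₀ hac]
    push_cast
    linear_combination (w + q) * ht
  · refine Summable.of_norm_bounded (hgeo.mul_left ρ⁻¹) fun n => ?_
    have h1 : √((a⁻¹) ^ (n + 1))⁻¹ = (ρ⁻¹) ^ (n + 1) := by
      rw [hρa, ← pow_mul, mul_comm, pow_mul, ← inv_pow, ← inv_pow,
        Real.sqrt_sq (by positivity)]
    calc ‖((a : ℂ)⁻¹) ^ n • affineComp ((a⁻¹) ^ (n + 1)) _ (hrpos n) (hre n)‖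
        ≤ (ρ ^ 2) ^ n * (ρ⁻¹) ^ (n + 1) := by
          rw [norm_smul, norm_pow, norm_inv, hnc, ← hρa, ← h1]
          gcongr
          exact norm_affineComp_le _ _
      _ = ρ⁻¹ * ρ ^ n := by
          have h2 : ρ ^ n * ρ⁻¹ ^ n = 1 := by rw [← mul_pow, mul_inv_cancel₀ hρ0.ne', one_pow]
          rw [← pow_mul, mul_comm 2 n, pow_mul, pow_succ]
          linear_combination ρ ^ n * ρ⁻¹ * h2
  · rw [← summable_nat_add_iff 1]
    set K := 2 * ‖q‖ / (q.re * (1 - a⁻¹)) with hK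
    refine Summable.of_norm_bounded (hgeo.mul_left (a * ρ * K)) fun n => ?_
    have h1 : √(a ^ (n + 1))⁻¹ = ρ ^ (n + 1) := by
      rw [← inv_pow, hρa, ← pow_mul, mul_comm, pow_mul, Real.sqrt_sq (by positivity)]
    have h2 := norm_compositionOperator_pow_mul_le (hψ := hψ) h ha hq hbq n
    rw [h1, ← hK] at h2
    rw [norm_smul, inv_inv, norm_pow, hnc]
    calc a ^ (n + 1 + 1) * ‖compositionOperator ψ hψ ^ (n + 1) *
          (1 - affineComp 1 q one_pos hq.le)‖
        ≤ a ^ (n + 1 + 1) * (ρ ^ (n + 1) * (K * (a ^ (n + 1))⁻¹)) := by gcongr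
      _ = a * ρ * K * ρ ^ n := by field_simp; ring

theorem isUniversal_compositionOperator (h : ∀ w : RightHalfPlane, (ψ w : ℂ) = a * w + b)
    (ha : 1 < a) (hb : 0 < b.re) : IsUniversal
      (compositionOperator ψ hψ - ((a : ℂ)⁻¹) • ContinuousLinearMap.id ℂ HardySpace) := by
  have ha0 : 0 < a := zero_lt_one.trans ha
  have hac : (a : ℂ) ≠ 0 := by exact_mod_cast ha0.ne'
  have ha1 : 0 < a - 1 := sub_pos.mpr ha
  have ha1c : (a - 1 : ℂ) ≠ 0 := by exact_mod_cast ha1.ne'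
  set q : ℂ := b / (a - 1) with hqdef
  have hbq : b = (a - 1) * q := by rw [hqdef]; field_simp
  have hq : 0 < q.re := by
    rw [hqdef, show (a - 1 : ℂ) = ((a - 1 : ℝ) : ℂ) by push_cast; ring, Complex.div_ofReal_re]
    positivity
  obtain ⟨S, hS⟩ := exists_rightInverse_compositionOperator (hψ := hψ) h ha hq hbq
  set U := compositionOperator ψ hψ - ((a : ℂ)⁻¹) • ContinuousLinearMap.id ℂ HardySpace with hU
  have hker : ∀ k, quasiPeriodic ha hq k ∈ U.ker := by
    intro k
    change U (quasiPeriodic ha hq k) = 0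
    refine ext_of_extend fun w hw => ?_
    have h1 : U (quasiPeriodic ha hq k) = compositionOperator ψ hψ (quasiPeriodic ha hq k)
        - (a : ℂ)⁻¹ • quasiPeriodic ha hq k := rfl
    have h2 : 0 < (a * w + b).re := by
      rw [Complex.add_re, Complex.re_ofReal_mul]
      have := mul_pos ha0 hw
      linarith
    have h3 : a * w + b + q = a * (w + q) := by rw [hbq]; ring
    rw [h1, extend_sub, extend_smul, extend_compositionOperator h _ hw,
      extend_quasiPeriodic ha hq k hw, extend_quasiPeriodic ha hq k h2,
      logPeriodic_scale ha hq hw h3, h3, mul_inv, mul_assoc, sub_self, extend_zero]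
  obtain ⟨J, hJ⟩ := exists_isometry_into_submodule U.ker U.isClosed_ker (quasiPeriodic ha hq)
    (linearIndependent_quasiPeriodic ha hq) hker
  exact isUniversal_of_rightInverse_of_isometry U S J hS hJ

instance : Nontrivial HardySpace := by
  have hq : 0 < (1 : ℂ).re := by simp
  exact ⟨_, 0, (linearIndependent_quasiPeriodic one_lt_two hq).ne_zero 0⟩

theorem exists_ne_zero_sq_eq_zero :
    ∃ T : HardySpace →L[ℂ] HardySpace, T ≠ 0 ∧ ∀ x, T (T x) = 0 := by
  have hq : 0 < (1 : ℂ).re := by simp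
  have hli := linearIndependent_quasiPeriodic one_lt_two hq
  set e := quasiPeriodic one_lt_two hq with he
  set w₀ : RightHalfPlane := ⟨1, hq⟩ with hw₀
  set φ := evalCLM w₀ with hφ
  have hval : ∀ k, φ (e k) = ((1 : ℂ) + 1)⁻¹ * logPeriodic 2 1 1 ^ k := fun k => by
    rw [hφ, evalCLM_apply, ← extend_of_pos _ w₀.2, he, extend_quasiPeriodic one_lt_two hq k w₀.2]
  -- A nonzero element of the kernel of `φ`; the rank-one operator `φ ⊗ v` has square zero.
  set v := e 1 - logPeriodic 2 1 1 • e 0 with hv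
  have hφv : φ v = 0 := by
    rw [hv, map_sub, map_smul, hval, hval, smul_eq_mul]
    ring
  have hv0 : v ≠ 0 := by
    intro h0
    have h1 := linearIndependent_iff'.mp hli {0, 1}
      (fun k => if k = 1 then 1 else -logPeriodic 2 1 1) (by
        rw [Finset.sum_pair zero_ne_one, ← h0, hv]
        simp
        abel) 1 (by simp)
    simp at h1
  have hφ0 : φ (e 0) ≠ 0 := by
    rw [hval]; norm_num
  refine ⟨φ.smulRight v, fun h0 => ?_, fun x => ?_⟩
  · have h1 := congrArg (fun A : HardySpace →L[ℂ] HardySpace => A (e 0)) h0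
    exact smul_ne_zero hφ0 hv0 h1
  · simp [hφv]

end HardySpace

theorem mainTheorem1 (ψ : RightHalfPlane → RightHalfPlane) (hψ : IsAffineSelfMap ψ) :
    (∃ μ : ℂ, IsUniversal (compositionOperator ψ hψ - μ • ContinuousLinearMap.id ℂ HardySpace)) ↔
      IsHyperbolicNonAutTypeII ψ := by
  constructor
  · rintro ⟨μ, hμ⟩
    obtain ⟨a, b, ha, hb, h⟩ := hψ.exists_real
    by_cases hab : a = 1 ∨ b.re = 0
    · obtain ⟨T, hT, hT2⟩ := HardySpace.exists_ne_zero_sq_eq_zero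
      exact absurd hμ (not_isUniversal_of_ker_sq (ker_sq_sub_smul_of_paranormal
        (HardySpace.compositionOperator_paranormal h ha hb hab) μ) hT hT2)
    push Not at hab
    have hb0 : 0 < b.re := lt_of_le_of_ne hb hab.2.symm
    rcases lt_or_gt_of_ne hab.1 with ha1 | ha1
    · refine absurd hμ (not_isUniversal_of_injective fun f hf => ?_)
      refine HardySpace.eq_zero_of_compositionOperator_eq_smul (hψ := hψ) h ha ha1 hb0 (μ := μ)
        (sub_eq_zero.mp ?_)
      simpa using hf
    · exact ⟨a, b, ha1, hb0, h⟩
  · rintro ⟨a, b, ha, hb, h⟩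
    exact ⟨_, HardySpace.isUniversal_compositionOperator h ha hb⟩
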